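/- **Setting.** Let $K\ge 1$ and let $\mathcal D_1,\dots,\mathcal D_K$ be probability distributions supported on $[0,1]$, with means $\theta_1,\dots,\theta_K$. Let $\theta\in(0,1)$ be a threshold and put $\Delta_i=|\theta_i-\theta|$. Pulling arm $i$ for the $s$-th time yields the reward $X_{i,s}\sim\mathcal D_i$, where all $X_{i,s}$ ($1\le i\le K$, $s\ge1$) are independent. Let $T_i(t)$ be the number of pulls of arm $i$ in the first $t$ rounds, $\hat\theta_i(t)=\frac1{T_i(t)}\sum_{s=1}^{T_i(t)}X_{i,s}$, and $\hat\Delta_i(t)=|\hat\theta_i(t)-\theta|$. For $\alpha>0$, the algorithm LSA pulls each arm once in the first $K$ rounds; in each round $t=K+1,\dots,T$ it pulls an arm $i$ minimising $$\alpha\,T_i(t-1)\,\hat\Delta_i(t-1)^2+\tfrac12\ln T_i(t-1)$$ (ties broken arbitrarily); after $T$ rounds it outputs $d_i=1$ if $\hat\theta_i(T)\ge\theta$ and $d_i=0$ otherwise. The label $d_i$ is correct if ($d_i=0\iff\theta_i<\theta$). The aggregate regret $\mathcal R^{\mathrm{LSA}}(T)$ is the expected number of arms $i$ whose label is incorrect.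 For $x\in\mathbb R$ let $$\lambda_i(x)=\begin{cases}\exp(2x), & x\le\ln\Delta_i^{-1},\\[2pt] \dfrac{x-\ln\Delta_i^{-1}+\alpha}{\alpha\Delta_i^2}, & x>\ln\Delta_i^{-1},\end{cases}$$ where $\ln\Delta_i^{-1}=+\infty$ if $\Delta_i=0$. **Theorem.** Let $0<\alpha\le 8$ and let $T$ be an integer with $T\ge\max\{40/\alpha+1,\,40\}\cdot K$. Then the equation $$\sum_{i=1}^K\lambda_i(x)=\frac{T}{\max\{40/\alpha+1,\,40\}}$$ has a unique real solution $x=\Lambda$, and with $\lambda_i=\lambda_i(\Lambda)$, $$\mathcal R^{\mathrm{LSA}}(T)\le\Phi(\alpha)\sum_{i=1}^K\exp\!\left(-\frac{\lambda_i\Delta_i^2}{10}\right),\qquad \Phi(\alpha)=\frac{9.3\cdot 2^{1/(8\alpha)}}{2^{1/(8\alpha)}-1}\exp\!\left(\frac{2.1\,\alpha-\ln\alpha-0.5}{4\alpha}\right).$$ -/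

import Mathlib

open MeasureTheory ProbabilityTheory

noncomputable section

namespace ThresholdingBandit

/-- `X i s` is the reward of the `(s+1)`-st pull of arm `i`: all rewards are independent, and
those of arm `i` have law `ν i`. -/
structure IsRewardTable {Ω : Type*} [MeasurableSpace Ω] {K : ℕ} (P : Measure Ω)
    (ν : Fin K → Measure ℝ) (X : Fin K → ℕ → Ω → ℝ) : Prop where
  measurable : ∀ i s, Measurable (X i s)
  law : ∀ i s, P.map (X i s) = ν i
  indep : iIndepFun (fun p : Fin K × ℕ => X p.1 p.2) P

/-- The mean `θ_i` of arm `i`. -/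
def armMean {K : ℕ} (ν : Fin K → Measure ℝ) (i : Fin K) : ℝ := ∫ x, x ∂(ν i)

/-- The gap `Δ_i = |θ_i - θ|`. -/
def gap {K : ℕ} (θ : ℝ) (ν : Fin K → Measure ℝ) (i : Fin K) : ℝ := |armMean ν i - θ|

section Run

variable {Ω : Type*} {K : ℕ}

/-- `T_i(t)`: the number of pulls of arm `i` in the first `t` rounds, where `I s ω` is the arm
pulled in round `s + 1`. -/
def pullCount (I : ℕ → Ω → Fin K) (t : ℕ) (i : Fin K) (ω : Ω) : ℕ :=
  ((Finset.range t).filter (fun s => I s ω = i)).card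

/-- `θ̂_{i,n}`: the empirical mean of the first `n` rewards of arm `i`. -/
def sampleMean (X : Fin K → ℕ → Ω → ℝ) (i : Fin K) (n : ℕ) (ω : Ω) : ℝ :=
  (∑ s ∈ Finset.range n, X i s ω) / n

/-- `θ̂_i(t)`: the empirical mean of arm `i` after `t` rounds. -/
def empMean (X : Fin K → ℕ → Ω → ℝ) (I : ℕ → Ω → Fin K) (t : ℕ) (i : Fin K) (ω : Ω) : ℝ :=
  sampleMean X i (pullCount I t i ω) ω

/-- `Δ̂_i(t) = |θ̂_i(t) - θ|`: the empirical gap of arm `i` after `t` rounds. -/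
def empGap (θ : ℝ) (X : Fin K → ℕ → Ω → ℝ) (I : ℕ → Ω → Fin K) (t : ℕ) (i : Fin K) (ω : Ω) : ℝ :=
  |empMean X I t i ω - θ|

/-- The index `α T_i(t) Δ̂_i(t)² + ½ ln T_i(t)`. -/
def lsaIndex (α θ : ℝ) (X : Fin K → ℕ → Ω → ℝ) (I : ℕ → Ω → Fin K) (t : ℕ) (i : Fin K)
    (ω : Ω) : ℝ :=
  α * (pullCount I t i ω : ℝ) * empGap θ X I t i ω ^ 2
    + (1 / 2) * Real.log (pullCount I t i ω : ℝ)

/-- `I` is the sequence of arms pulled by LSA during `T` rounds: each arm is pulled once in the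
first `K` rounds (in any order), and each later round pulls a minimiser of the index (with ties
broken in any way). -/
structure IsLSARun [MeasurableSpace Ω] (α θ : ℝ) (X : Fin K → ℕ → Ω → ℝ) (T : ℕ)
    (I : ℕ → Ω → Fin K) : Prop where
  measurable : ∀ t < T, Measurable (I t)
  init : ∀ ω i, pullCount I K i ω = 1
  argmin : ∀ t, K ≤ t → t < T → ∀ ω j,
    lsaIndex α θ X I t (I t ω) ω ≤ lsaIndex α θ X I t j ω

/-- The output `d_i` of LSA: `1` if `θ̂_i(T) ≥ θ`, and `0` otherwise. -/
def lsaOutput (θ : ℝ) (X : Fin K → ℕ → Ω → ℝ) (I : ℕ → Ω → Fin K) (T : ℕ) (i : Fin K)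
    (ω : Ω) : Fin 2 :=
  if θ ≤ empMean X I T i ω then 1 else 0

/-- The event that the label `d i` is correct; the label `0` stands for `θ_i < θ`. -/
def correctEvent (θ : ℝ) (ν : Fin K → Measure ℝ) (d : Fin K → Ω → Fin 2) (i : Fin K) : Set Ω :=
  {ω | d i ω = 0 ↔ armMean ν i < θ}

/-- The aggregate regret: the expected number of incorrect labels. -/
def aggregateRegret [MeasurableSpace Ω] (P : Measure Ω) (θ : ℝ) (ν : Fin K → Measure ℝ)
    (d : Fin K → Ω → Fin 2) : ℝ :=
  ∫ ω, ∑ i, (correctEvent θ ν d i)ᶜ.indicator (fun _ => (1 : ℝ)) ω ∂P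

end Run

/-- `exp (2x)` if `x ≤ ln Δ⁻¹`, and `(x - ln Δ⁻¹ + α) / (α Δ²)` if `x > ln Δ⁻¹`, where
`ln Δ⁻¹ = +∞` for `Δ = 0`. -/
def allocation (α Δ x : ℝ) : ℝ :=
  if Δ = 0 ∨ x ≤ Real.log Δ⁻¹ then Real.exp (2 * x)
  else (x - Real.log Δ⁻¹ + α) / (α * Δ ^ 2)

/-- `max {40/α + 1, 40}`. -/
def budgetFactor (α : ℝ) : ℝ := max (40 / α + 1) 40

/-- `x` solves the equation that defines the level `Λ`. -/
def IsLevel {K : ℕ} (α : ℝ) (Δ : Fin K → ℝ) (T : ℕ) (x : ℝ) : Prop :=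
  ∑ i, allocation α (Δ i) x = T / budgetFactor α

/-- The constant `Φ(α)`. -/
def lsaConst (α : ℝ) : ℝ :=
  9.3 * (2 : ℝ) ^ (1 / (8 * α)) / ((2 : ℝ) ^ (1 / (8 * α)) - 1)
    * Real.exp ((2.1 * α - Real.log α - 0.5) / (4 * α))

end ThresholdingBandit

end

/-! Arms with `Λ ≤ ln Δ_i⁻¹` cost nothing: there `λ_i Δ_i² ≤ 1`, so the claimed bound exceeds one.
For any other arm put `w = (Λ - ln Δ_i⁻¹) / 2` and `y = Λ - w`. Since `λ_i Δ_i² / 10 = w / (5α) +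
1/10`, it suffices to bound the error probability by a constant times `exp (-w / (5α))`.

LSA always pulls a minimiser of the index. Hence either at some round all indices are at least `y`,
or every pull after initialisation is made at an index below `y`, and then `T - K` is at most the
sum over the arms of the last sample size at which the index is below `y`
(`exists_round_or_horizon_le`). This removes the adaptivity: those last times are functions of the
separate reward streams, hence independent.

In the first case arm `i` has index at least `y` after some `m` pulls
(`meas_incorrect_of_index_ge`). If `m ≥ w / (10 α Δ_i²)`, a wrong label requires a deviation by
`Δ_i` at a sample size at least `m`. If `m` is smaller, the index is atypically large for so few
samples; peeling over dyadic ranges of `m` bounds this, and the term `½ ln m` makes the dyadic sum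
geometric.

In the second case a Chernoff bound applies (`meas_horizon_le`). Each last time has exponential
moment at most `exp (3 τ λ_j)` (`lintegral_exp_lastTime_le`), while `T` is at least `40 ∑ λ_j`. The
resulting exponent is turned into `w / (5α)` by the growth of the allocation between `y` and `Λ`
(`exists_split_le_allocation`).

All deviations are uniform in the sample size, through Ville's inequality for the exponential
supermartingale of Hoeffding's lemma. -/

noncomputable section

namespace ThresholdingBandit

open scoped ENNReal

/-! ### Ville's inequality for products of independent factors -/

section Maximal

variable {Ω : Type*} [MeasurableSpace Ω] {P : Measure Ω}

/-- The partial products of a sequence, frozen as soon as they reach the level `x`. -/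
def stoppedProd (x : ℝ≥0∞) (g : ℕ → ℝ≥0∞) : ℕ → ℝ≥0∞
  | 0 => 1
  | n + 1 => if x ≤ stoppedProd x g n then stoppedProd x g n else stoppedProd x g n * g n

lemma stoppedProd_congr (x : ℝ≥0∞) {g h : ℕ → ℝ≥0∞} {n : ℕ} (hgh : ∀ k < n, g k = h k) :
    stoppedProd x g n = stoppedProd x h n := by
  induction n with
  | zero => rfl
  | succ n ih =>
    simp only [stoppedProd, ih fun k hk => hgh k (hk.trans n.lt_succ_self), hgh n n.lt_succ_self]

lemma measurable_stoppedProd (x : ℝ≥0∞) (n : ℕ) :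
    Measurable fun g : ℕ → ℝ≥0∞ => stoppedProd x g n := by
  induction n with
  | zero => exact measurable_const
  | succ n ih =>
    exact Measurable.ite (measurableSet_le measurable_const ih) ih
      (ih.mul (measurable_pi_apply n))

lemma le_stoppedProd_or (x : ℝ≥0∞) (g : ℕ → ℝ≥0∞) (n : ℕ) :
    x ≤ stoppedProd x g n ∨ (stoppedProd x g n = ∏ k ∈ Finset.range n, g k ∧
      ∀ m ≤ n, ¬ x ≤ ∏ k ∈ Finset.range m, g k) := by
  induction n with
  | zero =>
    by_cases h : x ≤ 1
    · exact Or.inl h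
    · refine Or.inr ⟨rfl, fun m hm => ?_⟩
      obtain rfl : m = 0 := by omega
      simpa using h
  | succ n ih =>
    by_cases hx : x ≤ stoppedProd x g n
    · left
      simp only [stoppedProd, if_pos hx]
      exact hx
    · obtain ⟨heq, hno⟩ := ih.resolve_left hx
      have hs : stoppedProd x g (n + 1) = ∏ k ∈ Finset.range (n + 1), g k := by
        rw [Finset.prod_range_succ, ← heq]
        simp only [stoppedProd, if_neg hx]
      by_cases h : x ≤ stoppedProd x g (n + 1)
      · exact Or.inl h
      · refine Or.inr ⟨hs, fun m hm => ?_⟩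
        rcases Nat.lt_or_eq_of_le hm with hlt | rfl
        · exact hno m (by omega)
        · rwa [← hs]

/-- The stopped product at time `n` reads only the factors before `n`; `ext` pads these with ones to
a full sequence, so that it becomes a measurable function of a finite block. -/
lemma indepFun_stoppedProd {g : ℕ → Ω → ℝ≥0∞} (hg : ∀ k, Measurable (g k))
    (hind : iIndepFun g P) (x : ℝ≥0∞) (n : ℕ) :
    IndepFun (fun ω => stoppedProd x (fun k => g k ω) n) (g n) P := by
  have h := hind.indepFun_finset (Finset.range n) {n} (by simp) hg
  let ext : (Finset.range n → ℝ≥0∞) → ℕ → ℝ≥0∞ := fun v k =>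
    if hk : k ∈ Finset.range n then v ⟨k, hk⟩ else 1
  have hext : Measurable ext := by
    refine measurable_pi_lambda _ fun k => ?_
    by_cases hk : k ∈ Finset.range n
    · simp only [ext, hk, dite_true]
      exact measurable_pi_apply _
    · simp only [ext, hk, dite_false]
      exact measurable_const
  have hproj : Measurable fun v : ({n} : Finset ℕ) → ℝ≥0∞ => v ⟨n, Finset.mem_singleton_self n⟩ :=
    measurable_pi_apply _
  have h' := h.comp (φ := fun v => stoppedProd x (ext v) n)
    ((measurable_stoppedProd x n).comp hext) hproj
  convert h' using 1
  · ext ω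
    refine stoppedProd_congr x fun k hk => ?_
    simp [ext, hk]
  · rfl

/-- Supermartingale property: the frozen part `a (W)` stays put, and only the running part `b (W)`
is multiplied by the next factor, which is independent of it and has mean at most one. -/
lemma lintegral_stoppedProd_le [IsProbabilityMeasure P] {g : ℕ → Ω → ℝ≥0∞}
    (hg : ∀ k, Measurable (g k)) (hind : iIndepFun g P) (hint : ∀ k, ∫⁻ ω, g k ω ∂P ≤ 1)
    (x : ℝ≥0∞) (n : ℕ) :
    ∫⁻ ω, stoppedProd x (fun k => g k ω) n ∂P ≤ 1 := by
  induction n with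
  | zero => simp [stoppedProd]
  | succ n ih =>
    refine le_trans ?_ ih
    set W : Ω → ℝ≥0∞ := fun ω => stoppedProd x (fun k => g k ω) n with hW
    have hWm : Measurable W :=
      (measurable_stoppedProd x n).comp (measurable_pi_lambda _ hg)
    let a : ℝ≥0∞ → ℝ≥0∞ := fun v => if x ≤ v then v else 0
    let b : ℝ≥0∞ → ℝ≥0∞ := fun v => if x ≤ v then 0 else v
    have ham : Measurable a := Measurable.ite measurableSet_Ici measurable_id measurable_const
    have hbm : Measurable b := Measurable.ite measurableSet_Ici measurable_const measurable_id
    have hsplit : ∀ ω, stoppedProd x (fun k => g k ω) (n + 1) = a (W ω) + b (W ω) * g n ω := by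
      intro ω
      by_cases h : x ≤ W ω
      · have h' : x ≤ stoppedProd x (fun k => g k ω) n := h
        simp [stoppedProd, a, b, h', hW]
      · have h' : ¬ x ≤ stoppedProd x (fun k => g k ω) n := h
        simp [stoppedProd, a, b, h', hW]
    have haW : Measurable fun ω => a (W ω) := ham.comp hWm
    have hab : ∀ ω, a (W ω) + b (W ω) = W ω := by
      intro ω
      by_cases h : x ≤ W ω <;> simp [a, b, h]
    have hI : IndepFun (fun ω => b (W ω)) (g n) P :=
      (indepFun_stoppedProd hg hind x n).comp hbm measurable_id
    calc ∫⁻ ω, stoppedProd x (fun k => g k ω) (n + 1) ∂P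
        = ∫⁻ ω, a (W ω) ∂P + (∫⁻ ω, b (W ω) ∂P) * ∫⁻ ω, g n ω ∂P := by
          rw [lintegral_congr hsplit, lintegral_add_left haW]
          congr 1
          exact lintegral_mul_eq_lintegral_mul_lintegral_of_indepFun (hbm.comp hWm) (hg n) hI
      _ ≤ ∫⁻ ω, a (W ω) ∂P + (∫⁻ ω, b (W ω) ∂P) * 1 := by gcongr; exact hint n
      _ = ∫⁻ ω, W ω ∂P := by
          rw [mul_one, ← lintegral_add_left haW]
          exact lintegral_congr hab

/-- Ville's maximal inequality for products of independent nonnegative factors of mean at most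
one. -/
theorem mul_meas_exists_le_prod_le_one [IsProbabilityMeasure P] {g : ℕ → Ω → ℝ≥0∞}
    (hg : ∀ k, Measurable (g k)) (hind : iIndepFun g P) (hint : ∀ k, ∫⁻ ω, g k ω ∂P ≤ 1)
    (x : ℝ≥0∞) (N : ℕ) :
    x * P {ω | ∃ m ≤ N, x ≤ ∏ k ∈ Finset.range m, g k ω} ≤ 1 := by
  have hWm : Measurable fun ω => stoppedProd x (fun k => g k ω) N :=
    (measurable_stoppedProd x N).comp (measurable_pi_lambda _ hg)
  refine le_trans ?_ (lintegral_stoppedProd_le hg hind hint x N)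
  refine le_trans ?_ (mul_meas_ge_le_lintegral hWm x)
  refine mul_le_mul_right (measure_mono ?_) x
  rintro ω ⟨m, hm, hx⟩
  exact (le_stoppedProd_or x (fun k => g k ω) N).resolve_right fun h => h.2 m hm hx

end Maximal

/-! ### Time-uniform Hoeffding bounds -/

section Hoeffding

variable {Ω : Type*} [MeasurableSpace Ω] {P : Measure Ω}

/-- A sequence of independent random variables with the moment generating function bound of
centred variables supported on an interval of length one. -/
structure IsHoeffdingSeq (P : Measure Ω) (Z : ℕ → Ω → ℝ) : Prop where
  measurable : ∀ k, Measurable (Z k)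
  indep : iIndepFun Z P
  mgf_le : ∀ k s, ∫⁻ ω, ENNReal.ofReal (Real.exp (s * Z k ω)) ∂P
    ≤ ENNReal.ofReal (Real.exp (s ^ 2 / 8))

lemma IsHoeffdingSeq.const_mul {Z : ℕ → Ω → ℝ} (h : IsHoeffdingSeq P Z) {ε : ℝ}
    (hε : ε ^ 2 = 1) : IsHoeffdingSeq P fun k ω => ε * Z k ω where
  measurable k := (h.measurable k).const_mul ε
  indep := h.indep.comp (fun _ z => ε * z) fun _ => measurable_id.const_mul ε
  mgf_le k s := by
    have := h.mgf_le k (s * ε)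
    rw [mul_pow, hε, mul_one] at this
    simpa only [mul_assoc] using this

lemma IsHoeffdingSeq.neg {Z : ℕ → Ω → ℝ} (h : IsHoeffdingSeq P Z) :
    IsHoeffdingSeq P fun k ω => -Z k ω := by
  simpa using h.const_mul (ε := -1) (by norm_num)

lemma isHoeffdingSeq_of_mem_Icc [IsProbabilityMeasure P] {X : ℕ → Ω → ℝ}
    (hm : ∀ k, Measurable (X k)) (hind : iIndepFun X P)
    (hb : ∀ k, ∀ᵐ ω ∂P, X k ω ∈ Set.Icc (0 : ℝ) 1) {c : ℝ} (hc : ∀ k, ∫ ω, X k ω ∂P = c) :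
    IsHoeffdingSeq P fun k ω => X k ω - c where
  measurable k := (hm k).sub_const c
  indep := hind.comp (fun _ z => z - c) fun _ => measurable_id.sub_const c
  mgf_le k s := by
    have h := hasSubgaussianMGF_of_mem_Icc (hm k).aemeasurable (hb k)
    rw [hc k] at h
    have h2 := h.mgf_le s
    rw [← ofReal_integral_eq_lintegral_ofReal (h.integrable_exp_mul s)
      (Filter.Eventually.of_forall fun ω => (Real.exp_pos _).le)]
    refine ENNReal.ofReal_le_ofReal (h2.trans (le_of_eq ?_))
    congr 1
    simp
    ring

variable [IsProbabilityMeasure P] {Z : ℕ → Ω → ℝ}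

/-- Ville's inequality for the factors `exp (s Z_k - s² / 8)`, whose means are at most one. -/
lemma IsHoeffdingSeq.meas_exists_ge_le (h : IsHoeffdingSeq P Z) (s a : ℝ) (N : ℕ) :
    P {ω | ∃ m ≤ N, a ≤ s * ∑ k ∈ Finset.range m, Z k ω - m * (s ^ 2 / 8)}
      ≤ ENNReal.ofReal (Real.exp (-a)) := by
  let g : ℕ → Ω → ℝ≥0∞ := fun k ω => ENNReal.ofReal (Real.exp (s * Z k ω - s ^ 2 / 8))
  have hφ : Measurable fun z : ℝ => ENNReal.ofReal (Real.exp (s * z - s ^ 2 / 8)) := by fun_prop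
  have hgm : ∀ k, Measurable (g k) := fun k => hφ.comp (h.measurable k)
  have hgi : iIndepFun g P :=
    h.indep.comp (fun _ z => ENNReal.ofReal (Real.exp (s * z - s ^ 2 / 8))) fun _ => hφ
  have hint : ∀ k, ∫⁻ ω, g k ω ∂P ≤ 1 := by
    intro k
    have : ∀ ω, g k ω = ENNReal.ofReal (Real.exp (s * Z k ω))
        * ENNReal.ofReal (Real.exp (-(s ^ 2 / 8))) := fun ω => by
      rw [← ENNReal.ofReal_mul (Real.exp_pos _).le, ← Real.exp_add, ← sub_eq_add_neg]
    have hmz := h.measurable k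
    rw [lintegral_congr this, lintegral_mul_const _ (by fun_prop)]
    calc _ ≤ ENNReal.ofReal (Real.exp (s ^ 2 / 8)) * ENNReal.ofReal (Real.exp (-(s ^ 2 / 8))) := by
          gcongr; exact h.mgf_le k s
      _ = 1 := by
          rw [← ENNReal.ofReal_mul (Real.exp_pos _).le, ← Real.exp_add]; simp
  have hprod : ∀ m ω, ∏ k ∈ Finset.range m, g k ω
      = ENNReal.ofReal (Real.exp (s * ∑ k ∈ Finset.range m, Z k ω - m * (s ^ 2 / 8))) := by
    intro m ω
    rw [← ENNReal.ofReal_prod_of_nonneg fun _ _ => (Real.exp_pos _).le, ← Real.exp_sum,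
      Finset.sum_sub_distrib, Finset.mul_sum]
    simp
  have key := mul_meas_exists_le_prod_le_one hgm hgi hint (ENNReal.ofReal (Real.exp a)) N
  simp only [hprod, ENNReal.ofReal_le_ofReal_iff (Real.exp_pos _).le, Real.exp_le_exp] at key
  calc _ = ENNReal.ofReal (Real.exp (-a)) * (ENNReal.ofReal (Real.exp a) * P {ω | ∃ m ≤ N,
        a ≤ s * ∑ k ∈ Finset.range m, Z k ω - m * (s ^ 2 / 8)}) := by
        rw [← mul_assoc, ← ENNReal.ofReal_mul (Real.exp_pos _).le, ← Real.exp_add]; simp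
    _ ≤ ENNReal.ofReal (Real.exp (-a)) * 1 := by gcongr
    _ = _ := mul_one _

/-- A deviation by `δ` of an empirical mean over at least `b` samples. -/
lemma IsHoeffdingSeq.meas_exists_deviation_le (h : IsHoeffdingSeq P Z) {δ : ℝ} (hδ : 0 ≤ δ)
    (b : ℝ) (N : ℕ) :
    P {ω | ∃ m ≤ N, b ≤ (m : ℝ) ∧ m * δ ≤ ∑ k ∈ Finset.range m, Z k ω}
      ≤ ENNReal.ofReal (Real.exp (-(2 * b * δ ^ 2))) := by
  -- The slope `s = 4δ` maximises `s m δ - m s² / 8`, with value `2 m δ²`.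
  refine le_trans (measure_mono ?_) (h.meas_exists_ge_le (4 * δ) (2 * b * δ ^ 2) N)
  rintro ω ⟨m, hm, hb, hd⟩
  refine ⟨m, hm, ?_⟩
  have h1 := mul_le_mul_of_nonneg_left hd (by positivity : 0 ≤ 4 * δ)
  have h2 := mul_le_mul_of_nonneg_right hb (sq_nonneg δ)
  nlinarith

/-- A nonnegative variable whose tail at `t` is at most `t⁻²` has mean at most two. -/
lemma lintegral_ofReal_le_two {f : Ω → ℝ} (hf : Measurable f) (hf0 : ∀ ω, 0 ≤ f ω)
    (htail : ∀ t > 0, P {ω | t ≤ f ω} ≤ ENNReal.ofReal (t ^ (-2 : ℝ))) :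
    ∫⁻ ω, ENNReal.ofReal (f ω) ∂P ≤ 2 := by
  rw [lintegral_eq_lintegral_meas_le P (Filter.Eventually.of_forall hf0) hf.aemeasurable,
    ← Set.Ioc_union_Ioi_eq_Ioi (zero_le_one (α := ℝ)),
    lintegral_union measurableSet_Ioi (Set.Ioc_disjoint_Ioi le_rfl)]
  have h1 : ∫⁻ t in Set.Ioc (0 : ℝ) 1, P {ω | t ≤ f ω} ≤ 1 := by
    calc _ ≤ ∫⁻ t in Set.Ioc (0 : ℝ) 1, 1 := lintegral_mono fun t => prob_le_one
      _ = 1 := by simp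
  have h2 : ∫⁻ t in Set.Ioi (1 : ℝ), P {ω | t ≤ f ω} ≤ 1 := by
    calc _ ≤ ∫⁻ t in Set.Ioi (1 : ℝ), ENNReal.ofReal (t ^ (-2 : ℝ)) :=
          setLIntegral_mono' measurableSet_Ioi fun t ht => htail t (zero_lt_one.trans ht)
      _ = ENNReal.ofReal (∫ t in Set.Ioi (1 : ℝ), t ^ (-2 : ℝ)) := by
          rw [ofReal_integral_eq_lintegral_ofReal
            (integrableOn_Ioi_rpow_of_lt (by norm_num) one_pos)]
          filter_upwards [ae_restrict_mem measurableSet_Ioi] with t ht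
          exact Real.rpow_nonneg (zero_le_one.trans (Set.mem_Ioi.1 ht).le) _
      _ = 1 := by
          rw [integral_Ioi_rpow_of_lt (by norm_num) one_pos]; norm_num
  calc _ ≤ (1 : ℝ≥0∞) + 1 := add_le_add h1 h2
    _ = 2 := by norm_num

end Hoeffding

/-! ### Independence across arms -/

section Blocks

variable {Ω ι : Type*} [MeasurableSpace Ω] {P : Measure Ω} [IsProbabilityMeasure P]

/-- Products of functions of disjoint blocks of an independent array integrate to products. -/
lemma lintegral_prod_blocks {X : ι → ℕ → Ω → ℝ} (hm : ∀ i s, Measurable (X i s))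
    (hind : iIndepFun (fun p : ι × ℕ => X p.1 p.2) P) (N : ℕ) {F : ι → (ℕ → ℝ) → ℝ≥0∞}
    (hF : ∀ i, Measurable (F i))
    (hdep : ∀ i x x', (∀ k < N, x k = x' k) → F i x = F i x') (S : Finset ι) :
    ∫⁻ ω, ∏ i ∈ S, F i (fun k => X i k ω) ∂P = ∏ i ∈ S, ∫⁻ ω, F i (fun k => X i k ω) ∂P := by
  classical
  have hFm : ∀ i, Measurable fun ω => F i (fun k => X i k ω) := fun i =>
    (hF i).comp (measurable_pi_lambda _ (hm i))
  induction S using Finset.induction_on with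
  | empty => simp
  | insert j S hj ih =>
    simp only [Finset.prod_insert hj]
    rw [← ih]
    refine lintegral_mul_eq_lintegral_mul_lintegral_of_indepFun'' (hFm j).aemeasurable
      (Finset.measurable_prod S fun i _ => hFm i).aemeasurable ?_
    have hd : Disjoint (({j} : Finset ι) ×ˢ Finset.range N) (S ×ˢ Finset.range N) := by
      rw [Finset.disjoint_left]
      rintro ⟨a, b⟩ h1 h2
      simp only [Finset.mem_product, Finset.mem_singleton] at h1 h2
      exact hj (h1.1 ▸ h2.1)
    let ext : (A : Finset ι) → ((A ×ˢ Finset.range N : Finset (ι × ℕ)) → ℝ) → ι → ℕ → ℝ :=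
      fun A v i k => if hk : (i, k) ∈ A ×ˢ Finset.range N then v ⟨(i, k), hk⟩ else 0
    have hext : ∀ A i, Measurable fun v => ext A v i := by
      intro A i
      refine measurable_pi_lambda _ fun k => ?_
      by_cases hk : (i, k) ∈ A ×ˢ Finset.range N
      · simp only [ext, hk, dite_true]
        exact measurable_pi_apply _
      · simp only [ext, hk, dite_false]
        exact measurable_const
    have hval : ∀ (A : Finset ι), ∀ i ∈ A, ∀ ω, F i (fun k => X i k ω)
        = F i (ext A (fun p => X p.1.1 p.1.2 ω) i) := by
      intro A i hi ω
      refine hdep i _ _ fun k hk => ?_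
      have : (i, k) ∈ A ×ˢ Finset.range N := by simp [hi, hk]
      simp [ext, hi, hk]
    have h := (hind.indepFun_finset _ _ hd fun p => hm p.1 p.2).comp
      (φ := fun v => F j (ext {j} v j)) (ψ := fun v => ∏ i ∈ S, F i (ext S v i))
      ((hF j).comp (hext _ j))
      (Finset.measurable_prod S fun i _ => (hF i).comp (hext S i))
    convert h using 1
    · ext ω
      exact hval {j} j (by simp) ω
    · ext ω
      exact Finset.prod_congr rfl fun i hi => hval S i hi ω

end Blocks

/-! ### The index of one arm: early large values and last small value -/

section SingleArm

variable {Ω : Type*} [MeasurableSpace Ω] {P : Measure Ω} [IsProbabilityMeasure P]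
  {Z : ℕ → Ω → ℝ} {α Δ : ℝ}

/-- The index after `m` pulls of an arm with gap `Δ`, where `Z` are the centred rewards, with the
sign chosen such that positive values pull the empirical mean towards the threshold. -/
def centredIndex (α Δ : ℝ) (Z : ℕ → Ω → ℝ) (m : ℕ) (ω : Ω) : ℝ :=
  α * m * (Δ - (∑ k ∈ Finset.range m, Z k ω) / m) ^ 2 + 1 / 2 * Real.log m

/-- A large index on one dyadic range of sample sizes. -/
lemma meas_exists_index_ge_dyadic (h : IsHoeffdingSeq P Z) (hα : 0 < α) (hΔ : 0 < Δ) (y : ℝ)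
    {R : ℝ} (hR : 0 < R) (N : ℕ) :
    P {ω | ∃ m ≤ N, R / (2 * Δ ^ 2) ≤ (m : ℝ) ∧ (m : ℝ) ≤ R / Δ ^ 2 ∧ y ≤ centredIndex α Δ Z m ω}
      ≤ ENNReal.ofReal
        (2 * Real.exp (R - (y + Real.log Δ - 1 / 2 * Real.log R) / (2 * α))) := by
  set a := y + Real.log Δ - 1 / 2 * Real.log R with ha
  -- If `a / (2α) ≤ R`, the claimed bound is at least two. Otherwise `ρ² ≥ 2`, where `ρ Δ` is the
  -- smallest empirical gap compatible with an index of at least `y` in this range.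
  rcases le_or_gt (a / (2 * α)) R with hc | hc
  · refine prob_le_one.trans ?_
    rw [← ENNReal.ofReal_one]
    refine ENNReal.ofReal_le_ofReal ?_
    have := Real.one_le_exp (sub_nonneg.2 hc)
    linarith
  have ha2 : R * (2 * α) < a := (lt_div_iff₀ (by positivity)).1 hc
  have ha0 : 0 < a := lt_trans (by positivity) ha2
  set ρ := Real.sqrt (a / (α * R)) with hρ
  have hρ2 : ρ ^ 2 = a / (α * R) := Real.sq_sqrt (by positivity)
  have hρ1 : 1 ≤ ρ := by
    rw [hρ, Real.one_le_sqrt, le_div_iff₀ (by positivity)]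
    nlinarith [mul_pos hα hR]
  set δ := (ρ - 1) * Δ with hδ
  have hδ0 : 0 ≤ δ := mul_nonneg (by linarith) hΔ.le
  have hbound : Real.exp (-(2 * (R / (2 * Δ ^ 2)) * δ ^ 2)) ≤ Real.exp (R - a / (2 * α)) := by
    refine Real.exp_le_exp.2 ?_
    have e1 : 2 * (R / (2 * Δ ^ 2)) * δ ^ 2 = R * (ρ - 1) ^ 2 := by
      rw [hδ]; field_simp
    have e2 : a / (2 * α) = R * (ρ ^ 2 / 2) := by
      rw [hρ2]; field_simp
    rw [e1, e2]
    -- `(ρ - 1)² = ρ² / 2 - 1 + (ρ - 2)² / 2`.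
    nlinarith [mul_nonneg hR.le (sq_nonneg (ρ - 2))]
  have hp := (h.meas_exists_deviation_le hδ0 (R / (2 * Δ ^ 2)) N).trans
    (ENNReal.ofReal_le_ofReal hbound)
  have hn := (h.neg.meas_exists_deviation_le hδ0 (R / (2 * Δ ^ 2)) N).trans
    (ENNReal.ofReal_le_ofReal hbound)
  rw [two_mul (Real.exp _), ENNReal.ofReal_add (Real.exp_pos _).le (Real.exp_pos _).le]
  refine le_trans (measure_mono ?_) ((measure_union_le _ _).trans (add_le_add hp hn))
  rintro ω ⟨m, hm, hlo, hhi, hy⟩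
  have hm0 : (0 : ℝ) < m := lt_of_lt_of_le (by positivity) hlo
  set e := Δ - (∑ k ∈ Finset.range m, Z k ω) / m with he
  have hlog : Real.log m ≤ Real.log R - 2 * Real.log Δ := by
    have := Real.log_le_log hm0 hhi
    rwa [Real.log_div hR.ne' (by positivity), Real.log_pow] at this
  have hy' : y ≤ α * m * e ^ 2 + 1 / 2 * Real.log m := hy
  have h1 : a ≤ α * m * e ^ 2 := by rw [ha]; linarith
  have h2 : (ρ * Δ) ^ 2 ≤ e ^ 2 := by
    rw [mul_pow, hρ2]
    have hmR : (m : ℝ) * Δ ^ 2 ≤ R := (le_div_iff₀ (by positivity)).1 hhi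
    have h3 : α * m * e ^ 2 * Δ ^ 2 ≤ α * R * e ^ 2 := by
      have := mul_le_mul_of_nonneg_left hmR (by positivity : 0 ≤ α * e ^ 2)
      nlinarith
    rw [div_mul_eq_mul_div, div_le_iff₀ (by positivity)]
    nlinarith [mul_le_mul_of_nonneg_right h1 (sq_nonneg Δ)]
  have h3 : ρ * Δ ≤ |e| := (le_abs_self _).trans (sq_le_sq.1 h2)
  have hsum : ∑ k ∈ Finset.range m, Z k ω = m * (Δ - e) := by
    rw [he]; field_simp; ring
  rcases le_abs.1 h3 with h4 | h4
  · right
    refine ⟨m, hm, hlo, ?_⟩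
    rw [Finset.sum_neg_distrib, hsum, ← mul_neg]
    exact mul_le_mul_of_nonneg_left (by rw [hδ]; linarith) hm0.le
  · left
    refine ⟨m, hm, hlo, ?_⟩
    rw [hsum]
    exact mul_le_mul_of_nonneg_left (by rw [hδ]; linarith) hm0.le

/-- A large index at some small sample size. -/
lemma meas_exists_index_ge_early (h : IsHoeffdingSeq P Z) (hα : 0 < α) (hΔ : 0 < Δ) (y : ℝ)
    {r : ℝ} (hr : 0 < r) (N : ℕ) :
    P {ω | ∃ m ≤ N, 1 ≤ m ∧ (m : ℝ) ≤ r / Δ ^ 2 ∧ y ≤ centredIndex α Δ Z m ω}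
      ≤ ENNReal.ofReal
        (2 * Real.exp (r - (y + Real.log Δ - 1 / 2 * Real.log r) / (2 * α))
          / (1 - Real.exp (-(Real.log 2 / (4 * α))))) := by
  set C := 2 * Real.exp (r - (y + Real.log Δ - 1 / 2 * Real.log r) / (2 * α)) with hC
  set q := Real.exp (-(Real.log 2 / (4 * α))) with hq
  have hq0 : 0 ≤ q := (Real.exp_pos _).le
  have hq1 : q < 1 := by
    rw [hq, Real.exp_lt_one_iff]
    have := Real.log_pos one_lt_two
    have : 0 < Real.log 2 / (4 * α) := by positivity
    linarith
  have hC0 : 0 ≤ C := by positivity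
  -- Halving `R` lowers `½ ln R` by `½ ln 2`, so each further dyadic range gains the factor `q`; the
  -- summand `R` in the exponent is simply bounded by `r`.
  let R : ℕ → ℝ := fun k => r * (1 / 2) ^ k
  have hR : ∀ k, 0 < R k := fun k => by positivity
  let A : ℕ → Set Ω := fun k => {ω | ∃ m ≤ N, R k / (2 * Δ ^ 2) ≤ (m : ℝ) ∧ (m : ℝ) ≤ R k / Δ ^ 2 ∧
    y ≤ centredIndex α Δ Z m ω}
  have hA : ∀ k, P (A k) ≤ ENNReal.ofReal (C * q ^ k) := by
    intro k
    refine (meas_exists_index_ge_dyadic h hα hΔ y (hR k) N).trans (ENNReal.ofReal_le_ofReal ?_)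
    rw [hC, hq, mul_assoc, ← Real.exp_nat_mul, ← Real.exp_add]
    have hRk : R k ≤ r := mul_le_of_le_one_right hr.le (pow_le_one₀ (by norm_num) (by norm_num))
    have hlog : Real.log (R k) = Real.log r - k * Real.log 2 := by
      simp only [R]
      rw [Real.log_mul hr.ne' (by positivity), Real.log_pow, one_div, Real.log_inv]
      ring
    gcongr 2 * Real.exp ?_
    rw [hlog]
    have : (y + Real.log Δ - 1 / 2 * (Real.log r - k * Real.log 2)) / (2 * α)
        = (y + Real.log Δ - 1 / 2 * Real.log r) / (2 * α) + k * (Real.log 2 / (4 * α)) := by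
      field_simp; ring
    rw [this]
    linarith
  have hsum : HasSum (fun k => C * q ^ k) (C / (1 - q)) :=
    (hasSum_geometric_of_lt_one hq0 hq1).mul_left C
  calc _ ≤ P (⋃ k, A k) := by
        refine measure_mono ?_
        rintro ω ⟨m, hm, hm1, hhi, hy⟩
        have hm0 : (0 : ℝ) < m := by exact_mod_cast hm1
        have hmr : (m : ℝ) * Δ ^ 2 ≤ r := (le_div_iff₀ (by positivity)).1 hhi
        obtain ⟨k, hk1, hk2⟩ := exists_nat_pow_near_of_lt_one
          (x := m * Δ ^ 2 / r) (y := 1 / 2) (by positivity) ((div_le_one hr).2 hmr)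
          (by norm_num) (by norm_num)
        rw [lt_div_iff₀ hr, pow_succ] at hk1
        rw [div_le_iff₀ hr] at hk2
        refine Set.mem_iUnion.2 ⟨k, m, hm, ?_, ?_, hy⟩
        · rw [div_le_iff₀ (by positivity)]
          simp only [R]
          linarith
        · rw [le_div_iff₀ (by positivity)]
          simp only [R]
          linarith
    _ ≤ ∑' k, P (A k) := measure_iUnion_le _
    _ ≤ ∑' k, ENNReal.ofReal (C * q ^ k) := ENNReal.tsum_le_tsum hA
    _ = ENNReal.ofReal (C / (1 - q)) := by
        rw [← ENNReal.ofReal_tsum_of_nonneg (fun k => by positivity) hsum.summable, hsum.tsum_eq]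

/-- The exponential moment of a time at which the index is below `y`. -/
lemma lintegral_exp_lastTime_le (h : IsHoeffdingSeq P Z) (hα : 0 < α) (hΔ : 0 < Δ) {y : ℝ}
    (hy : 0 ≤ y + Real.log Δ) {N : ℕ} {S : Ω → ℕ}
    (hS : ∀ ω, S ω = 0 ∨ (1 ≤ S ω ∧ S ω ≤ N ∧ centredIndex α Δ Z (S ω) ω < y))
    {τ : ℝ} (hτ0 : 0 ≤ τ) (hτ : τ ≤ Δ ^ 2 / 2) :
    ∫⁻ ω, ENNReal.ofReal (Real.exp (τ * S ω)) ∂P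
      ≤ ENNReal.ofReal (Real.exp (3 * τ * ((y + Real.log Δ + α) / (α * Δ ^ 2)))) := by
  set w := y + Real.log Δ with hw
  -- `G` is the square root of the exponential supermartingale with slope `2Δ`. Ville's inequality
  -- at level `t²` gives its maximum `f` a tail `t⁻²`, hence a mean of at most two.
  let G : ℕ → Ω → ℝ := fun m ω =>
    Real.exp (1 / 2 * ((2 * Δ) * ∑ k ∈ Finset.range m, Z k ω - m * ((2 * Δ) ^ 2 / 8)))
  have hG : ∀ m, Measurable (G m) := by
    intro m
    have : Measurable fun ω => ∑ k ∈ Finset.range m, Z k ω :=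
      Finset.measurable_sum _ fun k _ => h.measurable k
    fun_prop
  have hne : (Finset.range (N + 1)).Nonempty := Finset.nonempty_range_add_one
  let f : Ω → ℝ := fun ω => (Finset.range (N + 1)).sup' hne fun m => G m ω
  have hfm : Measurable f := by
    have := Finset.measurable_sup' hne (f := G) fun m _ => hG m
    convert this using 1
    ext ω
    simp [f]
  have hGf : ∀ m ≤ N, ∀ ω, G m ω ≤ f ω := fun m hm ω =>
    Finset.le_sup' (fun m => G m ω) (Finset.mem_range.2 (Nat.lt_succ_of_le hm))
  have hf1 : ∀ ω, 1 ≤ f ω := fun ω => by simpa [G] using hGf 0 (Nat.zero_le N) ω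
  have hf2 : ∫⁻ ω, ENNReal.ofReal (f ω) ∂P ≤ 2 := by
    refine lintegral_ofReal_le_two hfm (fun ω => zero_le_one.trans (hf1 ω)) fun t ht => ?_
    have he : t ^ (-2 : ℝ) = Real.exp (-(2 * Real.log t)) := by
      rw [Real.rpow_def_of_pos ht]; congr 1; ring
    rw [he]
    refine le_trans (measure_mono ?_) (h.meas_exists_ge_le (2 * Δ) (2 * Real.log t) N)
    intro ω hω
    obtain ⟨m, hm, hmt⟩ := (Finset.le_sup'_iff hne).1 (show t ≤ f ω from hω)
    refine ⟨m, Nat.le_of_lt_succ (Finset.mem_range.1 hm), ?_⟩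
    have := (Real.log_le_iff_le_exp ht).2 hmt
    linarith
  -- The pathwise bound `hpath` is for the rate `Δ² / 2`; raising it to the power `p ≤ 1` reaches
  -- the rate `τ`, and Bernoulli's inequality keeps the result linear in `f`.
  set p := 2 * τ / Δ ^ 2 with hp
  have hp0 : 0 ≤ p := by positivity
  have hp1 : p ≤ 1 := by
    rw [hp, div_le_one (by positivity)]; linarith
  have hpτ : p * (Δ ^ 2 / 2) = τ := by rw [hp]; field_simp
  set c := Real.exp (p * (1 / 2 + w / α)) with hc
  have hwα : 0 ≤ w / α := div_nonneg hy hα.le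
  have hpath : ∀ ω, Real.exp (Δ ^ 2 / 2 * S ω) ≤ Real.exp (1 / 2 + w / α) * f ω := by
    intro ω
    by_cases hsmall : (S ω : ℝ) * Δ ^ 2 ≤ 1
    · calc _ ≤ Real.exp (1 / 2 + w / α) := Real.exp_le_exp.2 (by linarith)
        _ ≤ _ := le_mul_of_one_le_right (Real.exp_pos _).le (hf1 ω)
    · rcases hS ω with h0 | ⟨h1, hN, hV⟩
      · simp [h0] at hsmall
      · refine le_trans ?_ (mul_le_mul_of_nonneg_left (hGf (S ω) hN ω) (Real.exp_pos _).le)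
        generalize S ω = m at *
        have hm0 : (0 : ℝ) < m := by exact_mod_cast h1
        simp only [G]
        rw [← Real.exp_add]
        refine Real.exp_le_exp.2 ?_
        unfold centredIndex at hV
        set e := Δ - (∑ k ∈ Finset.range m, Z k ω) / m with he
        have hsum : ∑ k ∈ Finset.range m, Z k ω = m * (Δ - e) := by
          rw [he]; field_simp; ring
        -- Once `m Δ² > 1`, the term `½ ln m` is at least `ln Δ⁻¹`, so an index below `y` forces `α
        -- m e² ≤ w`.
        have hlog : 0 ≤ Real.log m + 2 * Real.log Δ := by
          have := Real.log_nonneg (not_le.1 hsmall).le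
          rwa [Real.log_mul hm0.ne' (by positivity), Real.log_pow] at this
        have h2 : m * e ^ 2 ≤ w / α := by
          rw [le_div_iff₀ hα]; nlinarith
        rw [hsum]
        nlinarith [mul_nonneg hm0.le (sq_nonneg (Δ - 2 * e))]
  have hpath' : ∀ ω, Real.exp (τ * S ω) ≤ c * (1 - p) + c * p * f ω := by
    intro ω
    have h1 : Real.exp (τ * S ω) = Real.exp (Δ ^ 2 / 2 * S ω) ^ p := by
      rw [← Real.exp_mul, ← hpτ]; congr 1; ring
    have h2 : f ω ^ p ≤ 1 + p * (f ω - 1) := by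
      have := rpow_one_add_le_one_add_mul_self (s := f ω - 1) (by linarith [hf1 ω]) hp0 hp1
      simpa using this
    calc _ ≤ (Real.exp (1 / 2 + w / α) * f ω) ^ p := by
          rw [h1]; exact Real.rpow_le_rpow (Real.exp_pos _).le (hpath ω) hp0
      _ = c * f ω ^ p := by
          rw [Real.mul_rpow (Real.exp_pos _).le (zero_le_one.trans (hf1 ω)), ← Real.exp_mul, hc,
            mul_comm p]
      _ ≤ c * (1 + p * (f ω - 1)) := mul_le_mul_of_nonneg_left h2 (Real.exp_pos _).le
      _ = _ := by ring
  have hc0 : 0 ≤ c := (Real.exp_pos _).le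
  calc _ ≤ ∫⁻ ω, (ENNReal.ofReal (c * (1 - p)) + ENNReal.ofReal (c * p) * ENNReal.ofReal (f ω)) ∂P := by
        refine lintegral_mono fun ω => ?_
        rw [← ENNReal.ofReal_mul (by positivity), ← ENNReal.ofReal_add]
        · exact ENNReal.ofReal_le_ofReal (hpath' ω)
        · exact mul_nonneg hc0 (by linarith)
        · exact mul_nonneg (by positivity) (zero_le_one.trans (hf1 ω))
    _ = ENNReal.ofReal (c * (1 - p)) + ENNReal.ofReal (c * p) * ∫⁻ ω, ENNReal.ofReal (f ω) ∂P := by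
        rw [lintegral_add_left measurable_const, lintegral_const_mul _ (by fun_prop)]
        simp
    _ ≤ ENNReal.ofReal (c * (1 - p)) + ENNReal.ofReal (c * p) * ENNReal.ofReal 2 := by
        gcongr; simpa using hf2
    _ = ENNReal.ofReal (c * (1 + p)) := by
        rw [← ENNReal.ofReal_mul (by positivity), ← ENNReal.ofReal_add
          (mul_nonneg hc0 (by linarith)) (by positivity)]
        congr 1; ring
    _ ≤ _ := by
        refine ENNReal.ofReal_le_ofReal ?_
        calc c * (1 + p) ≤ c * Real.exp p := by
              gcongr; linarith [Real.add_one_le_exp p]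
          _ = Real.exp (p * (3 / 2 + w / α)) := by
              rw [hc, ← Real.exp_add]; congr 1; ring
          _ ≤ _ := by
              refine Real.exp_le_exp.2 ?_
              have : 3 * τ * ((w + α) / (α * Δ ^ 2)) = p * (3 / 2 + 3 / 2 * (w / α)) := by
                rw [hp]; field_simp; ring
              rw [this]
              gcongr
              linarith

end SingleArm

/-! ### The allocation `λ_i` and the level `Λ` -/

section Allocation

variable {α Δ x y : ℝ}

lemma allocation_of_low (h : Δ = 0 ∨ x + Real.log Δ ≤ 0) : allocation α Δ x = Real.exp (2 * x) := by
  refine if_pos (h.imp_right fun h => ?_)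
  rw [Real.log_inv]
  linarith

lemma allocation_of_high (hΔ : Δ ≠ 0) (h : 0 < x + Real.log Δ) :
    allocation α Δ x = (x + Real.log Δ + α) / (α * Δ ^ 2) := by
  rw [allocation, if_neg, Real.log_inv, sub_neg_eq_add]
  rw [Real.log_inv, not_or]
  exact ⟨hΔ, by linarith⟩

lemma exp_two_mul_eq (hΔ : 0 < Δ) (x : ℝ) :
    Real.exp (2 * x) = Real.exp (2 * (x + Real.log Δ)) / Δ ^ 2 := by
  rw [eq_div_iff (by positivity)]
  nth_rewrite 1 [← Real.exp_log hΔ]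
  rw [← Real.exp_nat_mul, ← Real.exp_add]
  congr 1
  push_cast
  ring

lemma continuous_allocation (hα : 0 < α) (hΔ : 0 ≤ Δ) : Continuous (allocation α Δ) := by
  rcases hΔ.eq_or_lt with rfl | hΔ
  · have : allocation α 0 = fun x => Real.exp (2 * x) := funext fun x => allocation_of_low (Or.inl rfl)
    rw [this]
    fun_prop
  · have : allocation α Δ = fun x => if x ≤ -Real.log Δ then Real.exp (2 * x)
        else (x + Real.log Δ + α) / (α * Δ ^ 2) := by
      ext x
      split_ifs with h
      · exact allocation_of_low (Or.inr (by linarith))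
      · exact allocation_of_high hΔ.ne' (by linarith)
    rw [this]
    -- Both branches equal `1 / Δ²` at the junction `ln Δ⁻¹`.
    refine Continuous.if_le (by fun_prop) (by fun_prop) continuous_id continuous_const ?_
    rintro x rfl
    rw [exp_two_mul_eq hΔ]
    simp
    field_simp

lemma strictMono_allocation (hα : 0 < α) (hΔ : 0 ≤ Δ) : StrictMono (allocation α Δ) := by
  intro x x' hx
  have hexp : Real.exp (2 * x) < Real.exp (2 * x') := Real.exp_lt_exp.2 (by linarith)
  rcases hΔ.eq_or_lt with rfl | hΔ
  · rwa [allocation_of_low (Or.inl rfl), allocation_of_low (Or.inl rfl)]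
  rcases le_or_gt (x' + Real.log Δ) 0 with h' | h'
  · rwa [allocation_of_low (Or.inr h'), allocation_of_low (Or.inr (by linarith))]
  rw [allocation_of_high hΔ.ne' h']
  rcases le_or_gt (x + Real.log Δ) 0 with h | h
  · rw [allocation_of_low (Or.inr h), exp_two_mul_eq hΔ]
    calc _ ≤ 1 / Δ ^ 2 := by gcongr; exact Real.exp_le_one_iff.2 (by linarith)
      _ = α / (α * Δ ^ 2) := by field_simp
      _ < _ := by gcongr; linarith
  · rw [allocation_of_high hΔ.ne' h]
    gcongr

lemma allocation_zero (hΔ : 0 ≤ Δ) (hΔ1 : Δ ≤ 1) : allocation α Δ 0 = 1 := by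
  rw [allocation_of_low (Or.inr (by simpa using Real.log_nonpos hΔ hΔ1))]
  simp

lemma one_le_allocation (hα : 0 < α) (hΔ : 0 ≤ Δ) (hΔ1 : Δ ≤ 1) (hx : 0 ≤ x) :
    1 ≤ allocation α Δ x := by
  rw [← allocation_zero (α := α) hΔ hΔ1]
  exact (strictMono_allocation hα hΔ).monotone hx

lemma exp_le_allocation (hα : 0 < α) (hΔ : 0 ≤ Δ) (h : Δ = 0 ∨ y + Real.log Δ ≤ 0) (hyx : y ≤ x) :
    Real.exp (2 * y) ≤ allocation α Δ x := by
  rw [← allocation_of_low (α := α) h]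
  exact (strictMono_allocation hα hΔ).monotone hyx

lemma div_le_allocation (hα : 0 < α) (hΔ : 0 < Δ) (h : 0 < y + Real.log Δ) (hyx : y ≤ x) :
    (y + Real.log Δ + α) / (α * Δ ^ 2) ≤ allocation α Δ x := by
  rw [← allocation_of_high (α := α) hΔ.ne' h]
  exact (strictMono_allocation hα hΔ.le).monotone hyx

lemma allocation_mul_sq_le_one (hΔ : 0 ≤ Δ) (h : Δ = 0 ∨ x + Real.log Δ ≤ 0) :
    allocation α Δ x * Δ ^ 2 ≤ 1 := by
  rcases hΔ.eq_or_lt with rfl | hΔ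
  · simp
  · have h' := h.resolve_left hΔ.ne'
    rw [allocation_of_low h, exp_two_mul_eq hΔ, div_mul_cancel₀ _ (by positivity)]
    exact Real.exp_le_one_iff.2 (by linarith)

/-- Rescaled by `max (exp (-2y)) Δ²`, the allocation grows at least linearly in the part of
`x - y` above `ln Δ⁻¹` and exponentially in the part below. -/
lemma exists_split_le_allocation (hα : 0 < α) (hΔ : 0 ≤ Δ) (hyx : y ≤ x) :
    ∃ p z : ℝ, 0 ≤ p ∧ 0 ≤ z ∧ x - y ≤ p + z ∧
      p / α + Real.exp (2 * z) ≤ max (Real.exp (-(2 * y))) (Δ ^ 2) * allocation α Δ x := by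
  have hexp : ∀ {l : ℝ}, 0 ≤ l → Real.exp (-(2 * y)) * l ≤ max (Real.exp (-(2 * y))) (Δ ^ 2) * l :=
    fun hl => mul_le_mul_of_nonneg_right (le_max_left _ _) hl
  by_cases hlow : Δ = 0 ∨ x + Real.log Δ ≤ 0
  · refine ⟨0, x - y, le_rfl, by linarith, by linarith, ?_⟩
    rw [allocation_of_low hlow]
    refine le_trans (le_of_eq ?_) (hexp (Real.exp_pos _).le)
    rw [← Real.exp_add, zero_div, zero_add]
    congr 1
    ring
  · rw [not_or, not_le] at hlow
    have hΔ0 : 0 < Δ := lt_of_le_of_ne hΔ (Ne.symm hlow.1)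
    rw [allocation_of_high hlow.1 hlow.2]
    set v := x + Real.log Δ with hv
    have hrw : (v + α) / (α * Δ ^ 2) = (v / α + 1) / Δ ^ 2 := by field_simp
    have hv0 : 0 ≤ v / α := div_nonneg hlow.2.le hα.le
    rcases le_or_gt v (x - y) with h | h
    -- Here `y ≤ ln Δ⁻¹ < x`, and `p`, `z` are the lengths of the two pieces of `[y, x]` cut at `ln
    -- Δ⁻¹`.
    · refine ⟨v, x - y - v, hlow.2.le, by linarith, by linarith, ?_⟩
      refine le_trans ?_ (hexp (by rw [hrw]; positivity))
      have he : Real.exp (-(2 * y)) * ((v + α) / (α * Δ ^ 2))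
          = Real.exp (2 * (x - y - v)) * (v / α + 1) := by
        have h1 := exp_two_mul_eq hΔ0 (-Real.log Δ)
        have h2 : Real.exp (2 * (x - y - v)) = Real.exp (-(2 * y)) * Real.exp (2 * -Real.log Δ) := by
          rw [← Real.exp_add]; congr 1; rw [hv]; ring
        rw [hrw, h2, h1]
        simp
        ring
      rw [he]
      have h1 : 1 ≤ Real.exp (2 * (x - y - v)) := Real.one_le_exp (by linarith)
      nlinarith [mul_le_mul_of_nonneg_right h1 hv0]
    -- Here `y` already exceeds `ln Δ⁻¹`, and scaling by `Δ²` turns the allocation into exactly `v /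
    -- α + 1`.
    · refine ⟨v, 0, hlow.2.le, le_rfl, by linarith, ?_⟩
      refine le_trans (le_of_eq ?_) (mul_le_mul_of_nonneg_right (le_max_right _ _)
        (by rw [hrw]; positivity))
      rw [hrw]
      field_simp
      simp

/-- Linear growth lets a single arm exceed the budget, which gives the right end point for the
intermediate value theorem. -/
lemma mul_le_allocation (hα : 0 < α) (hΔ : 0 ≤ Δ) (hΔ1 : Δ ≤ 1) (hx : 0 ≤ x) :
    min 1 α⁻¹ * x ≤ allocation α Δ x := by
  obtain ⟨p, z, hp, hz, hpz, h⟩ := exists_split_le_allocation (y := 0) hα hΔ hx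
  have hmax : max (Real.exp (-(2 * 0))) (Δ ^ 2) = 1 := by
    rw [mul_zero, neg_zero, Real.exp_zero]
    exact max_eq_left (pow_le_one₀ hΔ hΔ1)
  rw [hmax, one_mul] at h
  refine le_trans ?_ h
  have h1 : min 1 α⁻¹ * p ≤ p / α := by
    rw [div_eq_inv_mul]
    exact mul_le_mul_of_nonneg_right (min_le_right _ _) hp
  have h2 : min 1 α⁻¹ * z ≤ 1 * z := mul_le_mul_of_nonneg_right (min_le_left _ _) hz
  have h3 : min 1 α⁻¹ * x ≤ min 1 α⁻¹ * (p + z) :=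
    mul_le_mul_of_nonneg_left (by linarith) (by positivity)
  have h4 := Real.add_one_le_exp (2 * z)
  linarith

variable {K : ℕ} {Δ : Fin K → ℝ} {T : ℕ}

lemma strictMono_sum_allocation (hK : 0 < K) (hα : 0 < α) (hΔ : ∀ i, 0 ≤ Δ i) :
    StrictMono fun x => ∑ i, allocation α (Δ i) x := by
  intro x x' hx
  have : Nonempty (Fin K) := ⟨⟨0, hK⟩⟩
  exact Finset.sum_lt_sum_of_nonempty Finset.univ_nonempty fun i _ =>
    strictMono_allocation hα (hΔ i) hx

lemma budgetFactor_pos (α : ℝ) : 0 < budgetFactor α :=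
  lt_of_lt_of_le (by norm_num) (le_max_right (40 / α + 1) 40)

lemma sum_allocation_zero_le (hΔ : ∀ i, 0 ≤ Δ i) (hΔ1 : ∀ i, Δ i ≤ 1)
    (hT : budgetFactor α * K ≤ T) :
    ∑ i, allocation α (Δ i) 0 ≤ T / budgetFactor α := by
  rw [le_div_iff₀ (budgetFactor_pos α)]
  simp only [fun i => allocation_zero (α := α) (hΔ i) (hΔ1 i)]
  simp
  linarith

lemma existsUnique_isLevel (hK : 0 < K) (hα : 0 < α) (hΔ : ∀ i, 0 ≤ Δ i) (hΔ1 : ∀ i, Δ i ≤ 1)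
    (hT : budgetFactor α * K ≤ T) : ∃! x, IsLevel α Δ T x := by
  have hmono := strictMono_sum_allocation hK hα hΔ
  have hcont : Continuous fun x => ∑ i, allocation α (Δ i) x :=
    continuous_finsetSum _ fun i _ => continuous_allocation hα (hΔ i)
  set c := min 1 α⁻¹ with hc
  have hc0 : 0 < c := lt_min one_pos (inv_pos.2 hα)
  set b := (T : ℝ) / budgetFactor α with hb
  have hb0 : 0 ≤ b := div_nonneg (Nat.cast_nonneg _) (budgetFactor_pos α).le
  have hx0 : 0 ≤ b / c := by positivity
  have hup : b ≤ ∑ i, allocation α (Δ i) (b / c) := by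
    calc b = c * (b / c) := by field_simp
      _ ≤ allocation α (Δ ⟨0, hK⟩) (b / c) := mul_le_allocation hα (hΔ _) (hΔ1 _) hx0
      _ ≤ _ := Finset.single_le_sum
        (fun i _ => zero_le_one.trans (one_le_allocation hα (hΔ i) (hΔ1 i) hx0))
        (Finset.mem_univ _)
  obtain ⟨x, -, hx⟩ := intermediate_value_Icc hx0 hcont.continuousOn
    ⟨sum_allocation_zero_le hΔ hΔ1 hT, hup⟩
  exact ⟨x, hx, fun x' hx' => hmono.injective (hx'.trans hx.symm)⟩

lemma IsLevel.nonneg (hK : 0 < K) (hα : 0 < α) (hΔ : ∀ i, 0 ≤ Δ i) (hΔ1 : ∀ i, Δ i ≤ 1)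
    (hT : budgetFactor α * K ≤ T) {x : ℝ} (hx : IsLevel α Δ T x) : 0 ≤ x := by
  refine (strictMono_sum_allocation hK hα hΔ).le_iff_le.1 ?_
  rw [show ∑ i, allocation α (Δ i) x = T / budgetFactor α from hx]
  exact sum_allocation_zero_le hΔ hΔ1 hT

end Allocation

/-! ### The last sample size with a small index -/

section LastBelow

/-- The largest `m` with `1 ≤ m ≤ N` and `v m < y`, or `0` if there is none. -/
def lastBelow (v : ℕ → ℝ) (y : ℝ) : ℕ → ℕ
  | 0 => 0
  | N + 1 => if v (N + 1) < y then N + 1 else lastBelow v y N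

lemma lastBelow_eq_zero_or (v : ℕ → ℝ) (y : ℝ) (N : ℕ) :
    lastBelow v y N = 0 ∨
      (1 ≤ lastBelow v y N ∧ lastBelow v y N ≤ N ∧ v (lastBelow v y N) < y) := by
  induction N with
  | zero => exact Or.inl rfl
  | succ N ih =>
    by_cases h : v (N + 1) < y
    · simp only [lastBelow, if_pos h]
      exact Or.inr ⟨by omega, le_rfl, h⟩
    · simp only [lastBelow, if_neg h]
      exact ih.imp_right fun h => ⟨h.1, by omega, h.2.2⟩

/-- The alternative `m = 0` serves arms never pulled again after initialisation. -/
lemma le_lastBelow {v : ℕ → ℝ} {y : ℝ} {N m : ℕ} (hm : m ≤ N) (hv : m = 0 ∨ v m < y) :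
    m ≤ lastBelow v y N := by
  induction N with
  | zero => omega
  | succ N ih =>
    by_cases h : v (N + 1) < y
    · simp only [lastBelow, if_pos h]
      exact hm
    · simp only [lastBelow, if_neg h]
      rcases Nat.lt_or_eq_of_le hm with hlt | rfl
      · exact ih (by omega)
      · exact absurd (hv.resolve_left (by omega)) h

lemma lastBelow_congr {v v' : ℕ → ℝ} {y : ℝ} {N : ℕ} (h : ∀ m ≤ N, v m = v' m) :
    lastBelow v y N = lastBelow v' y N := by
  induction N with
  | zero => rfl
  | succ N ih => simp only [lastBelow, h (N + 1) le_rfl, ih fun m hm => h m (by omega)]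

lemma measurable_lastBelow {β : Type*} [MeasurableSpace β] {v : β → ℕ → ℝ}
    (hv : ∀ m, Measurable fun b => v b m) (y : ℝ) (N : ℕ) :
    Measurable fun b => lastBelow (v b) y N := by
  induction N with
  | zero => exact measurable_const
  | succ N ih =>
    exact Measurable.ite (measurableSet_lt (hv _) measurable_const) measurable_const ih

end LastBelow

/-! ### Pull counts and the deterministic dichotomy -/

section Pulls

variable {Ω : Type*} {K : ℕ} {I : ℕ → Ω → Fin K} {ω : Ω}

lemma pullCount_succ (t : ℕ) (i : Fin K) :
    pullCount I (t + 1) i ω = pullCount I t i ω + if I t ω = i then 1 else 0 := by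
  unfold pullCount
  rw [Finset.range_add_one, Finset.filter_insert]
  split_ifs with h
  · rw [Finset.card_insert_of_notMem (by simp)]
  · rfl

lemma pullCount_mono {t t' : ℕ} (h : t ≤ t') (i : Fin K) :
    pullCount I t i ω ≤ pullCount I t' i ω :=
  Finset.card_le_card (Finset.filter_subset_filter _ (Finset.range_mono h))

lemma sum_pullCount (t : ℕ) : ∑ i, pullCount I t i ω = t := by
  unfold pullCount
  rw [← Finset.card_eq_sum_card_fiberwise fun _ _ => Finset.mem_univ _, Finset.card_range]

lemma pullCount_le (t : ℕ) (i : Fin K) : pullCount I t i ω ≤ t := by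
  calc pullCount I t i ω ≤ ∑ i, pullCount I t i ω :=
        Finset.single_le_sum (f := fun i => pullCount I t i ω) (fun _ _ => Nat.zero_le _)
          (Finset.mem_univ i)
    _ = t := sum_pullCount t

/-- The index of arm `i` after `m` pulls. -/
def indexAt (α θ : ℝ) (X : Fin K → ℕ → Ω → ℝ) (i : Fin K) (m : ℕ) (ω : Ω) : ℝ :=
  α * m * (sampleMean X i m ω - θ) ^ 2 + 1 / 2 * Real.log m

variable {α θ : ℝ} {X : Fin K → ℕ → Ω → ℝ} {T : ℕ}

lemma lsaIndex_eq_indexAt (t : ℕ) (i : Fin K) :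
    lsaIndex α θ X I t i ω = indexAt α θ X i (pullCount I t i ω) ω := by
  simp only [lsaIndex, indexAt, empGap, empMean, sq_abs]

/-- Either all indices are simultaneously at least `y` at some round, or the horizon is at most
the total of the last times at which the indices are below `y`. -/
lemma exists_round_or_horizon_le [MeasurableSpace Ω] (hI : IsLSARun α θ X T I) (hKT : K ≤ T)
    (y : ℝ) (ω : Ω) :
    (∃ t, K ≤ t ∧ t < T ∧ ∀ j, y ≤ indexAt α θ X j (pullCount I t j ω) ω) ∨
      T ≤ K + ∑ j, lastBelow (fun m => indexAt α θ X j m ω) y T := by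
  by_cases hex : ∃ t, K ≤ t ∧ t < T ∧ ∀ j, y ≤ indexAt α θ X j (pullCount I t j ω) ω
  · exact Or.inl hex
  right
  push Not at hex
  have hlow : ∀ t, K ≤ t → t < T →
      indexAt α θ X (I t ω) (pullCount I t (I t ω) ω) ω < y := by
    intro t h1 h2
    obtain ⟨j, hj⟩ := hex t h1 h2
    have := hI.argmin t h1 h2 ω j
    rw [lsaIndex_eq_indexAt, lsaIndex_eq_indexAt] at this
    exact this.trans_lt hj
  -- `m` is the count just before the latest pull of arm `j`, when its index was minimal and hence
  -- below `y`. The offset of one per arm adds up to the summand `K`.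
  have hlast : ∀ t, K ≤ t → t ≤ T → ∀ j, ∃ m, pullCount I t j ω = m + 1 ∧
      (m = 0 ∨ indexAt α θ X j m ω < y) := by
    intro t hKt
    induction t, hKt using Nat.le_induction with
    | base => exact fun _ j => ⟨0, hI.init ω j, Or.inl rfl⟩
    | succ t hKt ih =>
      intro htT j
      rw [pullCount_succ]
      split_ifs with hj
      · refine ⟨_, rfl, Or.inr ?_⟩
        have := hlow t hKt (by omega)
        rwa [hj] at this
      · exact ih (by omega) j
  have hle : ∀ j, pullCount I T j ω ≤ 1 + lastBelow (fun m => indexAt α θ X j m ω) y T := by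
    intro j
    obtain ⟨m, hm, hv⟩ := hlast T hKT le_rfl j
    have hmT : m ≤ T := by
      have := pullCount_le (I := I) (ω := ω) T j
      omega
    have := le_lastBelow (v := fun m => indexAt α θ X j m ω) hmT hv
    omega
  calc T = ∑ j, pullCount I T j ω := (sum_pullCount T).symm
    _ ≤ ∑ j, (1 + lastBelow (fun m => indexAt α θ X j m ω) y T) :=
        Finset.sum_le_sum fun j _ => hle j
    _ = _ := by simp [Finset.sum_add_distrib]

end Pulls

/-! ### Numerical estimates for the constant `Φ(α)` -/

section Numeric

variable {α : ℝ}

/-- The factor `exp ((2.1 α - ln α - 0.5) / (4 α))` of `Φ(α)`. -/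
def lsaExpConst (α : ℝ) : ℝ := Real.exp ((2.1 * α - Real.log α - 0.5) / (4 * α))

/-- The factor `2 ^ (1 / (8 α)) / (2 ^ (1 / (8 α)) - 1)` of `Φ(α)`. -/
def lsaGeomConst (α : ℝ) : ℝ := (2 : ℝ) ^ (1 / (8 * α)) / ((2 : ℝ) ^ (1 / (8 * α)) - 1)

lemma lsaConst_eq (α : ℝ) : lsaConst α = 9.3 * lsaGeomConst α * lsaExpConst α := by
  rw [lsaConst, lsaGeomConst, lsaExpConst, mul_div_assoc]

lemma one_le_lsaExpConst (hα : 0 < α) : 1 ≤ lsaExpConst α := by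
  refine Real.one_le_exp (div_nonneg ?_ (by positivity))
  have := Real.log_le_sub_one_of_pos hα
  linarith

lemma one_lt_two_rpow (hα : 0 < α) : 1 < (2 : ℝ) ^ (1 / (8 * α)) :=
  Real.one_lt_rpow one_lt_two (by positivity)

lemma one_le_lsaGeomConst (hα : 0 < α) : 1 ≤ lsaGeomConst α := by
  have := one_lt_two_rpow hα
  rw [lsaGeomConst, one_le_div (by linarith)]
  linarith

/-- With `s = 2 ^ (1 / (8α))` the ratio is `s⁻²`, and `s² / ((s - 1)(s + 1)) ≤ s / (s - 1)`. -/
lemma inv_one_sub_exp_le_lsaGeomConst (hα : 0 < α) :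
    (1 - Real.exp (-(Real.log 2 / (4 * α))))⁻¹ ≤ lsaGeomConst α := by
  have hs := one_lt_two_rpow hα
  have he : Real.exp (-(Real.log 2 / (4 * α))) = ((2 : ℝ) ^ (1 / (8 * α)))⁻¹ ^ 2 := by
    rw [Real.rpow_def_of_pos two_pos, ← Real.exp_neg, ← Real.exp_nat_mul]
    congr 1
    push_cast
    field_simp
    ring
  rw [he, lsaGeomConst]
  set s := (2 : ℝ) ^ (1 / (8 * α))
  have hs0 : 0 < s := by linarith
  have h1 : 1 - s⁻¹ ^ 2 = (s - 1) * (s + 1) / s ^ 2 := by field_simp; ring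
  have hs1 : 0 < s - 1 := by linarith
  rw [h1, inv_div, div_le_div_iff₀ (by positivity) hs1]
  nlinarith [mul_pos hs0 hs1]

/-- Converts the Chernoff exponent of the horizon event into the target rate. The bound `α exp (2z)
≥ 1 + ln α + 2z` supplies the `-ln α` in `Φ(α)`, which matters for small `α`. -/
lemma exp_neg_le_lsaExpConst_mul {p z u Q : ℝ} (hα : 0 < α) (hp : 0 ≤ p) (hz : 0 ≤ z)
    (hu : u ≤ p + z) (hQ : p / α + Real.exp (2 * z) ≤ Q) :
    Real.exp (-(18 * Q)) ≤ lsaExpConst α * Real.exp (-(u / (5 * α))) := by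
  rw [lsaExpConst, ← Real.exp_add]
  refine Real.exp_le_exp.2 ?_
  have h1 : Real.log α + 2 * z + 1 ≤ α * Real.exp (2 * z) := by
    have := Real.add_one_le_exp (Real.log α + 2 * z)
    rwa [Real.exp_add, Real.exp_log hα] at this
  have hαe : 0 < α * Real.exp (2 * z) := by positivity
  have h2 : u / (5 * α) ≤ (p + z) / (5 * α) := by gcongr
  have h3 : (p + z) / (5 * α) - 18 * (p / α + Real.exp (2 * z))
      ≤ (2.1 * α - Real.log α - 0.5) / (4 * α) := by
    rw [le_div_iff₀ (by positivity)]
    have : ((p + z) / (5 * α) - 18 * (p / α + Real.exp (2 * z))) * (4 * α)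
        = 0.8 * (p + z) - 72 * p - 72 * (α * Real.exp (2 * z)) := by
      field_simp; ring
    rw [this]
    linarith
  linarith

/-- The peeling exponent at `r = w / (10α)`: after the rate `w / (5α)` is split off, `-0.8 w`
remains in the numerator over `4α` and absorbs `ln (w / 10)`. -/
lemma exp_early_le {w : ℝ} (hα : 0 < α) (hw : 0 < w) :
    Real.exp (w / (10 * α) - (w - 1 / 2 * Real.log (w / (10 * α))) / (2 * α))
      ≤ lsaExpConst α * Real.exp (-(w / (5 * α))) := by
  rw [lsaExpConst, ← Real.exp_add]
  refine Real.exp_le_exp.2 ?_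
  have h1 : Real.log (w / (10 * α)) = Real.log (w / 10) - Real.log α := by
    rw [← Real.log_div (by positivity) hα.ne']; congr 1; field_simp
  have h2 := Real.log_le_sub_one_of_pos (by positivity : 0 < w / 10)
  rw [h1]
  have h3 : w / (10 * α) - (w - 1 / 2 * (Real.log (w / 10) - Real.log α)) / (2 * α)
      + w / (5 * α) = (Real.log (w / 10) - Real.log α - 0.8 * w) / (4 * α) := by
    field_simp; ring
  have h4 : (Real.log (w / 10) - Real.log α - 0.8 * w) / (4 * α)
      ≤ (2.1 * α - Real.log α - 0.5) / (4 * α) :=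
    div_le_div_of_nonneg_right (by linarith) (by positivity)
  linarith

lemma nine_tenths_le_exp : (9 / 10 : ℝ) ≤ Real.exp (-(1 / 10)) := by
  have := Real.add_one_le_exp (-(1 / 10 : ℝ))
  linarith

end Numeric

/-! ### Signed rewards and the horizon event -/

section Arms

variable {Ω : Type*} {K : ℕ} {ν : Fin K → Measure ℝ}
  {X : Fin K → ℕ → Ω → ℝ} {α θ : ℝ}

lemma armMean_mem_Icc [∀ i, IsProbabilityMeasure (ν i)]
    (hν : ∀ i, ∀ᵐ x ∂(ν i), x ∈ Set.Icc (0 : ℝ) 1) (i : Fin K) :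
    armMean ν i ∈ Set.Icc (0 : ℝ) 1 := by
  constructor
  · refine integral_nonneg_of_ae ?_
    filter_upwards [hν i] with x hx using hx.1
  · calc armMean ν i ≤ ∫ _, (1 : ℝ) ∂(ν i) := by
          refine integral_mono_ae (Integrable.of_mem_Icc 0 1 aemeasurable_id (hν i))
            (integrable_const _) ?_
          filter_upwards [hν i] with x hx using hx.2
      _ = 1 := by simp

lemma gap_nonneg (i : Fin K) : 0 ≤ gap θ ν i := abs_nonneg _

lemma gap_le_one [∀ i, IsProbabilityMeasure (ν i)]
    (hν : ∀ i, ∀ᵐ x ∂(ν i), x ∈ Set.Icc (0 : ℝ) 1) (hθ : θ ∈ Set.Ioo (0 : ℝ) 1)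
    (i : Fin K) : gap θ ν i ≤ 1 := by
  have := armMean_mem_Icc hν i
  exact abs_le.2 ⟨by linarith [this.1, hθ.2], by linarith [this.2, hθ.1]⟩

/-- The direction from the mean of arm `i` towards the threshold. -/
def armSign (θ : ℝ) (ν : Fin K → Measure ℝ) (i : Fin K) : ℝ := if θ ≤ armMean ν i then -1 else 1

lemma armSign_sq (i : Fin K) : armSign θ ν i ^ 2 = 1 := by
  unfold armSign; split_ifs <;> norm_num

lemma gap_eq_armSign_mul (i : Fin K) : gap θ ν i = armSign θ ν i * (θ - armMean ν i) := by
  unfold gap armSign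
  split_ifs with h
  · rw [abs_of_nonneg (by linarith)]; ring
  · rw [abs_of_neg (by linarith)]; ring

/-- The centred rewards of arm `i`, signed such that positive values point to the threshold. -/
def centredReward (θ : ℝ) (ν : Fin K → Measure ℝ) (X : Fin K → ℕ → Ω → ℝ) (i : Fin K) (k : ℕ)
    (ω : Ω) : ℝ :=
  armSign θ ν i * (X i k ω - armMean ν i)

lemma sum_centredReward {m : ℕ} (hm : 1 ≤ m) (i : Fin K) (ω : Ω) :
    ∑ k ∈ Finset.range m, centredReward θ ν X i k ω
      = m * (gap θ ν i + armSign θ ν i * (sampleMean X i m ω - θ)) := by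
  have hm0 : (m : ℝ) ≠ 0 := by positivity
  simp only [centredReward]
  rw [← Finset.mul_sum, Finset.sum_sub_distrib, gap_eq_armSign_mul, sampleMean]
  simp only [Finset.sum_const, Finset.card_range, nsmul_eq_mul]
  field_simp
  ring

lemma indexAt_eq_centredIndex (i : Fin K) (m : ℕ) (ω : Ω) :
    indexAt α θ X i m ω = centredIndex α (gap θ ν i) (centredReward θ ν X i) m ω := by
  rcases Nat.eq_zero_or_pos m with rfl | hm
  · simp [indexAt, centredIndex]
  · have hm0 : (m : ℝ) ≠ 0 := by positivity
    rw [indexAt, centredIndex, sum_centredReward hm, mul_div_cancel_left₀ _ hm0,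
      sub_add_cancel_left, neg_sq, mul_pow, armSign_sq, one_mul]

lemma le_sum_centredReward_of_incorrect {I : ℕ → Ω → Fin K} {T : ℕ} {i : Fin K} {ω : Ω}
    (h : ω ∉ correctEvent θ ν (lsaOutput θ X I T) i) (hn : 1 ≤ pullCount I T i ω) :
    pullCount I T i ω * gap θ ν i
      ≤ ∑ k ∈ Finset.range (pullCount I T i ω), centredReward θ ν X i k ω := by
  rw [sum_centredReward hn]
  refine mul_le_mul_of_nonneg_left ?_ (Nat.cast_nonneg _)
  have h' : ¬ (lsaOutput θ X I T i ω = 0 ↔ armMean ν i < θ) := h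
  simp only [lsaOutput, empMean] at h'
  unfold armSign
  by_cases h1 : θ ≤ armMean ν i <;> by_cases h2 : θ ≤ sampleMean X i (pullCount I T i ω) ω
  · simp [h1, h2] at h'
  · rw [if_pos h1]; linarith
  · rw [if_neg h1]; linarith
  · simp [h1, h2] at h'

variable [MeasurableSpace Ω] {P : Measure Ω} [IsProbabilityMeasure P]

lemma isHoeffdingSeq_centredReward (hν : ∀ i, ∀ᵐ x ∂(ν i), x ∈ Set.Icc (0 : ℝ) 1)
    (hX : IsRewardTable P ν X) (θ : ℝ) (i : Fin K) :
    IsHoeffdingSeq P (centredReward θ ν X i) := by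
  refine (isHoeffdingSeq_of_mem_Icc (hX.measurable i)
    (hX.indep.precomp (g := fun s => (i, s)) fun a b h => (Prod.mk.inj h).2) (fun k => ?_)
    (c := armMean ν i) fun k => ?_).const_mul (armSign_sq i)
  · have h := hν i
    rw [← hX.law i k] at h
    exact ae_of_ae_map (hX.measurable i k).aemeasurable h
  · rw [armMean, ← hX.law i k]
    exact (integral_map (hX.measurable i k).aemeasurable aestronglyMeasurable_id).symm

/-- The arms are unlikely to absorb the whole horizon while their indices stay below a level
`y ≤ Λ`. -/
lemma meas_horizon_le [∀ i, IsProbabilityMeasure (ν i)]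
    (hν : ∀ i, ∀ᵐ x ∂(ν i), x ∈ Set.Icc (0 : ℝ) 1)
    (hθ : θ ∈ Set.Ioo (0 : ℝ) 1) (hX : IsRewardTable P ν X) (hα : 0 < α) {T : ℕ} {Λ y : ℝ}
    (hΛ : IsLevel α (gap θ ν) T Λ) (hΛ0 : 0 ≤ Λ) (hy : y ≤ Λ) {j₀ : Fin K}
    (hj₀ : ∀ j, gap θ ν j₀ ≤ gap θ ν j) :
    P {ω | T ≤ K + ∑ j, lastBelow (fun m => indexAt α θ X j m ω) y T}
      ≤ ENNReal.ofReal (Real.exp (-(18 * (max (Real.exp (-(2 * y))) (gap θ ν j₀ ^ 2)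
        * allocation α (gap θ ν j₀) Λ)))) := by
  set D := max (Real.exp (-(2 * y))) (gap θ ν j₀ ^ 2) with hD
  have hD0 : 0 < D := lt_of_lt_of_le (Real.exp_pos _) (le_max_left _ _)
  -- The arms with `y > ln Δ_j⁻¹` satisfy `D ≤ Δ_j²`, so this rate is admissible in their moment
  -- bound. The others need no restriction: `½ ln m` alone keeps their last time below `exp (2y) ≤
  -- λ_j`.
  set τ := D / 2 with hτ
  have hτ0 : 0 < τ := by positivity
  let S : Fin K → Ω → ℕ := fun j ω => lastBelow (fun m => indexAt α θ X j m ω) y T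
  let lam : Fin K → ℝ := fun j => allocation α (gap θ ν j) Λ
  have hlam1 : ∀ j, 1 ≤ lam j := fun j =>
    one_le_allocation hα (gap_nonneg j) (gap_le_one hν hθ j) hΛ0
  have hmom : ∀ j, ∫⁻ ω, ENNReal.ofReal (Real.exp (τ * S j ω)) ∂P
      ≤ ENNReal.ofReal (Real.exp (3 * τ * lam j)) := by
    intro j
    by_cases hlow : gap θ ν j = 0 ∨ y + Real.log (gap θ ν j) ≤ 0
    · have hS : ∀ ω, (S j ω : ℝ) ≤ 3 * lam j := by
        intro ω
        have hl := exp_le_allocation hα (gap_nonneg j) hlow hy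
        rcases lastBelow_eq_zero_or (fun m => indexAt α θ X j m ω) y T with h0 | ⟨h1, -, h2⟩
        · have : (S j ω : ℝ) = 0 := by exact_mod_cast h0
          linarith [hlam1 j]
        · change 1 ≤ S j ω at h1
          change indexAt α θ X j (S j ω) ω < y at h2
          have hS0 : (0 : ℝ) < S j ω := by exact_mod_cast h1
          have h3 : 0 ≤ α * (S j ω) * (sampleMean X j (S j ω) ω - θ) ^ 2 := by positivity
          unfold indexAt at h2
          have h4 : (S j ω : ℝ) ≤ Real.exp (2 * y) :=
            (Real.log_le_iff_le_exp hS0).1 (by linarith)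
          have := hlam1 j
          simp only [lam] at *
          linarith
      calc _ ≤ ∫⁻ _, ENNReal.ofReal (Real.exp (3 * τ * lam j)) ∂P := by
            refine lintegral_mono fun ω => ENNReal.ofReal_le_ofReal (Real.exp_le_exp.2 ?_)
            have := mul_le_mul_of_nonneg_left (hS ω) hτ0.le
            linarith
        _ = _ := by simp
    · rw [not_or, not_le] at hlow
      have hgap : 0 < gap θ ν j := lt_of_le_of_ne (gap_nonneg j) (Ne.symm hlow.1)
      have hDle : D ≤ gap θ ν j ^ 2 := by
        refine max_le ?_ (pow_le_pow_left₀ (gap_nonneg j₀) (hj₀ j) 2)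
        calc Real.exp (-(2 * y)) ≤ Real.exp ((2 : ℕ) * Real.log (gap θ ν j)) := by
              refine Real.exp_le_exp.2 ?_
              push_cast
              linarith [hlow.2]
          _ = gap θ ν j ^ 2 := by rw [Real.exp_nat_mul, Real.exp_log hgap]
      refine (lintegral_exp_lastTime_le (isHoeffdingSeq_centredReward hν hX θ j) hα hgap hlow.2.le
        (N := T) (fun ω => ?_) hτ0.le (by linarith)).trans
        (ENNReal.ofReal_le_ofReal (Real.exp_le_exp.2 ?_))
      · simp only [← indexAt_eq_centredIndex]
        exact lastBelow_eq_zero_or (fun m => indexAt α θ X j m ω) y T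
      · exact mul_le_mul_of_nonneg_left (div_le_allocation hα hgap hlow.2 hy) (by positivity)
  -- The index as a function of one reward stream, so that the last times become functions of
  -- disjoint independent blocks.
  let v : (ℕ → ℝ) → ℕ → ℝ := fun x m =>
    α * m * ((∑ k ∈ Finset.range m, x k) / m - θ) ^ 2 + 1 / 2 * Real.log m
  let F : Fin K → (ℕ → ℝ) → ℝ≥0∞ := fun _ x => ENNReal.ofReal (Real.exp (τ * lastBelow (v x) y T))
  have hv : ∀ m, Measurable fun x => v x m := by
    intro m
    have : Measurable fun x : ℕ → ℝ => ∑ k ∈ Finset.range m, x k :=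
      Finset.measurable_sum _ fun k _ => measurable_pi_apply k
    fun_prop
  have hFm : ∀ j, Measurable (F j) := by
    intro j
    have h1 : Measurable fun x => ((lastBelow (v x) y T : ℕ) : ℝ) :=
      measurable_from_top.comp (measurable_lastBelow hv y T)
    fun_prop
  have hdep : ∀ j x x', (∀ k < T, x k = x' k) → F j x = F j x' := by
    intro j x x' hxx
    have : lastBelow (v x) y T = lastBelow (v x') y T := lastBelow_congr fun m hm => by
      simp only [v]
      rw [Finset.sum_congr rfl fun k hk => hxx k ((Finset.mem_range.1 hk).trans_le hm)]
    simp only [F, this]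
  have hprod : ∫⁻ ω, ENNReal.ofReal (Real.exp (τ * ∑ j, (S j ω : ℝ))) ∂P
      ≤ ENNReal.ofReal (Real.exp (3 * τ * ∑ j, lam j)) := by
    calc _ = ∫⁻ ω, ∏ j, F j (fun k => X j k ω) ∂P := by
          refine lintegral_congr fun ω => ?_
          rw [Finset.mul_sum, Real.exp_sum, ENNReal.ofReal_prod_of_nonneg
            fun _ _ => (Real.exp_pos _).le]
          rfl
      _ = ∏ j, ∫⁻ ω, F j (fun k => X j k ω) ∂P :=
          lintegral_prod_blocks hX.measurable hX.indep T hFm hdep Finset.univ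
      _ ≤ ∏ j, ENNReal.ofReal (Real.exp (3 * τ * lam j)) :=
          Finset.prod_le_prod' fun j _ => hmom j
      _ = _ := by
          rw [Finset.mul_sum, Real.exp_sum, ENNReal.ofReal_prod_of_nonneg
            fun _ _ => (Real.exp_pos _).le]
  have hSm : Measurable fun ω => ENNReal.ofReal (Real.exp (τ * ∑ j, (S j ω : ℝ))) := by
    have h1 : ∀ j, Measurable fun ω => (S j ω : ℝ) := fun j =>
      measurable_from_top.comp
        ((measurable_lastBelow hv y T).comp (measurable_pi_lambda _ (hX.measurable j)))
    have h2 : Measurable fun ω => ∑ j, (S j ω : ℝ) := Finset.measurable_sum _ fun j _ => h1 j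
    fun_prop
  set L := ∑ j, lam j with hL
  have hTL : (T : ℝ) = L * budgetFactor α := by
    have : L = T / budgetFactor α := hΛ
    rw [this, div_mul_cancel₀ _ (budgetFactor_pos α).ne']
  have hKL : (K : ℝ) ≤ L := by
    calc (K : ℝ) = ∑ _j : Fin K, (1 : ℝ) := by simp
      _ ≤ L := Finset.sum_le_sum fun j _ => hlam1 j
  have hL40 : L * 40 ≤ T := by
    rw [hTL]
    exact mul_le_mul_of_nonneg_left (le_max_right _ _) ((Nat.cast_nonneg K).trans hKL)
  have hj₀L : lam j₀ ≤ L :=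
    Finset.single_le_sum (f := lam) (fun j _ => zero_le_one.trans (hlam1 j)) (Finset.mem_univ j₀)
  set b := Real.exp (τ * (T - K)) with hb
  have hsub : {ω | T ≤ K + ∑ j, lastBelow (fun m => indexAt α θ X j m ω) y T}
      ⊆ {ω | ENNReal.ofReal b ≤ ENNReal.ofReal (Real.exp (τ * ∑ j, (S j ω : ℝ)))} := by
    intro ω hω
    refine ENNReal.ofReal_le_ofReal (Real.exp_le_exp.2 (mul_le_mul_of_nonneg_left ?_ hτ0.le))
    have : (T : ℝ) ≤ K + ∑ j, (S j ω : ℝ) := by exact_mod_cast hω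
    linarith
  have hb0 : ENNReal.ofReal b ≠ 0 := by simp [hb, Real.exp_pos]
  calc _ ≤ P {ω | ENNReal.ofReal b ≤ ENNReal.ofReal (Real.exp (τ * ∑ j, (S j ω : ℝ)))} :=
        measure_mono hsub
    _ ≤ (∫⁻ ω, ENNReal.ofReal (Real.exp (τ * ∑ j, (S j ω : ℝ))) ∂P) / ENNReal.ofReal b :=
        meas_ge_le_lintegral_div hSm.aemeasurable hb0 ENNReal.ofReal_ne_top
    _ ≤ ENNReal.ofReal (Real.exp (3 * τ * L)) / ENNReal.ofReal b := by gcongr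
    _ = ENNReal.ofReal (Real.exp (3 * τ * L - τ * (T - K))) := by
        rw [← ENNReal.ofReal_div_of_pos (Real.exp_pos _), ← Real.exp_sub]
    _ ≤ _ := by
        refine ENNReal.ofReal_le_ofReal (Real.exp_le_exp.2 ?_)
        have h1 : D * lam j₀ ≤ D * L := mul_le_mul_of_nonneg_left hj₀L hD0.le
        -- `36 = 40 - 1 - 3`, from `T ≥ 40 L`, `K ≤ L` and the moment exponent `3 τ L`.
        have h2 : τ * (36 * L) ≤ τ * (T - K - 3 * L) :=
          mul_le_mul_of_nonneg_left (by linarith) hτ0.le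
        have h3 : τ * (36 * L) = 18 * (D * L) := by rw [hτ]; ring
        simp only [lam] at h1
        linarith

end Arms

/-! ### Error probability of one arm and the aggregate regret -/

section Regret

variable {Ω : Type*} [MeasurableSpace Ω] {P : Measure Ω} [IsProbabilityMeasure P]
  {K : ℕ} {ν : Fin K → Measure ℝ} {X : Fin K → ℕ → Ω → ℝ} {α θ : ℝ} {T : ℕ} {I : ℕ → Ω → Fin K}

/-- An arm whose index reaches `y` is mislabelled with small probability. -/
lemma meas_incorrect_of_index_ge (hν : ∀ i, ∀ᵐ x ∂(ν i), x ∈ Set.Icc (0 : ℝ) 1)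
    (hX : IsRewardTable P ν X) (hα : 0 < α) (hI : IsLSARun α θ X T I) {i : Fin K}
    (hgap : 0 < gap θ ν i) {y w : ℝ} (hw : 0 < w) (hyw : y + Real.log (gap θ ν i) = w) :
    P {ω | ω ∉ correctEvent θ ν (lsaOutput θ X I T) i ∧
        ∃ t, K ≤ t ∧ t < T ∧ y ≤ indexAt α θ X i (pullCount I t i ω) ω}
      ≤ ENNReal.ofReal (Real.exp (-(w / (5 * α))) * (1 + 2 * lsaExpConst α * lsaGeomConst α)) := by
  set Δ := gap θ ν i with hΔ
  set Z := centredReward θ ν X i with hZ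
  -- Chosen so that the late deviation bound `exp (-2r)` is exactly `exp (-w / (5α))`.
  set r := w / (10 * α) with hr
  have hr0 : 0 < r := by positivity
  have hH : IsHoeffdingSeq P Z := isHoeffdingSeq_centredReward hν hX θ i
  have hlate := hH.meas_exists_deviation_le hgap.le (r / Δ ^ 2) T
  have hearly := meas_exists_index_ge_early hH hα hgap y hr0 T
  rw [hyw] at hearly
  have hlate' : Real.exp (-(2 * (r / Δ ^ 2) * Δ ^ 2)) = Real.exp (-(w / (5 * α))) := by
    congr 1
    rw [hr]
    field_simp
    ring
  have hearly' : 2 * Real.exp (r - (w - 1 / 2 * Real.log r) / (2 * α))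
      / (1 - Real.exp (-(Real.log 2 / (4 * α))))
      ≤ Real.exp (-(w / (5 * α))) * (2 * lsaExpConst α * lsaGeomConst α) := by
    have h1 := exp_early_le hα hw
    have h2 := inv_one_sub_exp_le_lsaGeomConst hα
    have h3 := one_le_lsaGeomConst hα
    calc _ = 2 * Real.exp (r - (w - 1 / 2 * Real.log r) / (2 * α))
          * (1 - Real.exp (-(Real.log 2 / (4 * α))))⁻¹ := div_eq_mul_inv _ _
      _ ≤ 2 * (lsaExpConst α * Real.exp (-(w / (5 * α)))) * lsaGeomConst α := by
          refine mul_le_mul (by linarith) h2 ?_ ?_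
          · rw [inv_nonneg, sub_nonneg, Real.exp_le_one_iff, neg_nonpos]
            have := Real.log_pos one_lt_two
            positivity
          · unfold lsaExpConst; positivity
      _ = _ := by ring
  rw [hlate'] at hlate
  rw [mul_add, mul_one, ENNReal.ofReal_add (Real.exp_pos _).le
    ((div_nonneg (by positivity) (sub_nonneg.2 (Real.exp_le_one_iff.2 (neg_nonpos.2
      (div_nonneg (Real.log_nonneg one_le_two) (by positivity)))))).trans hearly')]
  refine le_trans (measure_mono ?_) ((measure_union_le _ _).trans
    (add_le_add hlate (hearly.trans (ENNReal.ofReal_le_ofReal hearly'))))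
  rintro ω ⟨hbad, t, hKt, htT, hyt⟩
  have hm1 : 1 ≤ pullCount I t i ω := (hI.init ω i).symm.le.trans (pullCount_mono hKt i)
  have hmn : pullCount I t i ω ≤ pullCount I T i ω := pullCount_mono htT.le i
  rcases le_total (r / Δ ^ 2) (pullCount I t i ω : ℝ) with h | h
  · exact Or.inl ⟨pullCount I T i ω, pullCount_le T i, h.trans (by exact_mod_cast hmn),
      le_sum_centredReward_of_incorrect hbad (hm1.trans hmn)⟩
  · refine Or.inr ⟨pullCount I t i ω, hmn.trans (pullCount_le T i), hm1, h, ?_⟩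
    rwa [hZ, hΔ, ← indexAt_eq_centredIndex]

/-- The probability that LSA mislabels arm `i`. -/
lemma meas_incorrect_le [∀ i, IsProbabilityMeasure (ν i)]
    (hν : ∀ i, ∀ᵐ x ∂(ν i), x ∈ Set.Icc (0 : ℝ) 1) (hθ : θ ∈ Set.Ioo (0 : ℝ) 1)
    (hX : IsRewardTable P ν X) (hα : 0 < α) (hT : budgetFactor α * K ≤ T)
    (hI : IsLSARun α θ X T I) {Λ : ℝ} (hΛ : IsLevel α (gap θ ν) T Λ) (i : Fin K) :
    P (correctEvent θ ν (lsaOutput θ X I T) i)ᶜ ≤ ENNReal.ofReal (lsaConst α *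
      Real.exp (-(allocation α (gap θ ν i) Λ * gap θ ν i ^ 2) / 10)) := by
  have hK : 0 < K := i.pos
  have hΛ0 : 0 ≤ Λ := hΛ.nonneg hK hα gap_nonneg (gap_le_one hν hθ) hT
  have hC := one_le_lsaExpConst hα
  have hG := one_le_lsaGeomConst hα
  have hCG : 1 ≤ lsaExpConst α * lsaGeomConst α := one_le_mul_of_one_le_of_one_le hC hG
  have h910 := nine_tenths_le_exp
  rw [lsaConst_eq]
  by_cases hlow : gap θ ν i = 0 ∨ Λ + Real.log (gap θ ν i) ≤ 0
  · refine prob_le_one.trans ?_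
    rw [← ENNReal.ofReal_one]
    refine ENNReal.ofReal_le_ofReal ?_
    have h1 : Real.exp (-(1 / 10))
        ≤ Real.exp (-(allocation α (gap θ ν i) Λ * gap θ ν i ^ 2) / 10) := by
      refine Real.exp_le_exp.2 ?_
      have := allocation_mul_sq_le_one (α := α) (gap_nonneg i) hlow
      linarith
    nlinarith
  · rw [not_or, not_le] at hlow
    have hgap : 0 < gap θ ν i := lt_of_le_of_ne (gap_nonneg i) (Ne.symm hlow.1)
    -- Taking half makes `y` exceed `ln Δ_i⁻¹` and fall short of `Λ` by the same `w`, so both events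
    -- decay at the rate `w / (5α)`.
    set w := (Λ + Real.log (gap θ ν i)) / 2 with hw
    have hw0 : 0 < w := by linarith [hlow.2]
    set y := Λ - w with hy
    have hB : (40 : ℝ) * K ≤ T :=
      (mul_le_mul_of_nonneg_right (le_max_right _ _) (Nat.cast_nonneg K)).trans hT
    have hKT : K ≤ T := by
      have : (K : ℝ) ≤ T := by linarith [Nat.cast_nonneg (α := ℝ) K]
      exact_mod_cast this
    obtain ⟨j₀, -, hj₀⟩ := Finset.exists_min_image Finset.univ (gap θ ν) ⟨i, Finset.mem_univ i⟩
    obtain ⟨p, z, hp, hz, hpz, hQ⟩ := exists_split_le_allocation (x := Λ) (y := y) hα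
      (gap_nonneg (θ := θ) (ν := ν) j₀) (by linarith)
    have hhor := (meas_horizon_le hν hθ hX hα hΛ hΛ0 (by linarith : y ≤ Λ)
      fun j => hj₀ j (Finset.mem_univ j)).trans
      (ENNReal.ofReal_le_ofReal (exp_neg_le_lsaExpConst_mul hα hp hz hpz hQ))
    rw [show Λ - y = w by rw [hy]; ring] at hhor
    have hind := meas_incorrect_of_index_ge hν hX hα hI hgap hw0
      (show y + Real.log (gap θ ν i) = w by rw [hy, hw]; ring)
    refine le_trans (measure_mono ?_) ((measure_union_le _ _).trans (add_le_add hind hhor)) |>.trans ?_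
    · intro ω hω
      rcases exists_round_or_horizon_le hI hKT y ω with ⟨t, h1, h2, h3⟩ | h
      · exact Or.inl ⟨hω, t, h1, h2, h3 i⟩
      · exact Or.inr h
    · rw [← ENNReal.ofReal_add (by positivity) (by positivity)]
      refine ENNReal.ofReal_le_ofReal ?_
      have hE : Real.exp (-(allocation α (gap θ ν i) Λ * gap θ ν i ^ 2) / 10)
          = Real.exp (-(w / (5 * α))) * Real.exp (-(1 / 10)) := by
        rw [← Real.exp_add, allocation_of_high hlow.1 hlow.2]
        congr 1
        rw [show Λ + Real.log (gap θ ν i) = 2 * w by rw [hw]; ring]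
        field_simp
        ring
      rw [hE]
      have hCle : lsaExpConst α ≤ lsaExpConst α * lsaGeomConst α :=
        le_mul_of_one_le_right (by linarith) hG
      set A := lsaExpConst α * lsaGeomConst α with hA
      have h1 : 9.3 * A * (9 / 10) ≤ 9.3 * A * Real.exp (-(1 / 10)) := by gcongr
      -- Late deviation, early index and horizon contribute `1`, `2A` and `lsaExpConst α`, at most
      -- `4A` in total, against `9.3 * 0.9 * A`.
      have h2 : 1 + 2 * A + lsaExpConst α ≤ 9.3 * A * Real.exp (-(1 / 10)) := by
        norm_num at h1 ⊢
        linarith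
      have h3 := mul_le_mul_of_nonneg_left h2 (Real.exp_pos (-(w / (5 * α)))).le
      have e1 : 2 * lsaExpConst α * lsaGeomConst α = 2 * A := by rw [hA]; ring
      have e2 : 9.3 * lsaGeomConst α * lsaExpConst α = 9.3 * A := by rw [hA]; ring
      rw [e1, e2]
      linarith

/-- Linearity of expectation; the error events are replaced by measurable hulls of the same measure,
so that no measurability of `d` is needed. -/
lemma aggregateRegret_le {d : Fin K → Ω → Fin 2} {b : Fin K → ℝ} (hb : ∀ i, 0 ≤ b i)
    (h : ∀ i, P (correctEvent θ ν d i)ᶜ ≤ ENNReal.ofReal (b i)) :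
    aggregateRegret P θ ν d ≤ ∑ i, b i := by
  let M : Fin K → Set Ω := fun i => toMeasurable P (correctEvent θ ν d i)ᶜ
  have hM : ∀ i, MeasurableSet (M i) := fun i => measurableSet_toMeasurable _ _
  have hint : ∀ i, Integrable ((M i).indicator fun _ => (1 : ℝ)) P := fun i =>
    (integrable_const _).indicator (hM i)
  calc aggregateRegret P θ ν d ≤ ∫ ω, ∑ i, (M i).indicator (fun _ => (1 : ℝ)) ω ∂P := by
        refine integral_mono_of_nonneg (Filter.Eventually.of_forall fun ω => ?_)
          (integrable_finsetSum _ fun i _ => hint i) (Filter.Eventually.of_forall fun ω => ?_)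
        · exact Finset.sum_nonneg fun i _ => Set.indicator_nonneg (fun _ _ => zero_le_one) _
        · exact Finset.sum_le_sum fun i _ => Set.indicator_le_indicator_of_subset
            (subset_toMeasurable _ _) (fun _ => zero_le_one) ω
    _ = ∑ i, P.real (M i) := by
        rw [integral_finsetSum _ fun i _ => hint i]
        refine Finset.sum_congr rfl fun i _ => ?_
        rw [integral_indicator_const _ (hM i), smul_eq_mul, mul_one]
    _ ≤ ∑ i, b i := by
        refine Finset.sum_le_sum fun i _ => ?_
        rw [Measure.real, measure_toMeasurable]
        exact ENNReal.toReal_le_of_le_ofReal (hb i) (h i)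

end Regret

end ThresholdingBandit

end

theorem theorem1 {Ω : Type*} [MeasurableSpace Ω] (P : Measure Ω) [IsProbabilityMeasure P]
    {K : ℕ} (hK : 0 < K) (ν : Fin K → Measure ℝ) [∀ i, IsProbabilityMeasure (ν i)]
    (hν : ∀ i, ∀ᵐ x ∂(ν i), x ∈ Set.Icc (0 : ℝ) 1)
    (θ : ℝ) (hθ : θ ∈ Set.Ioo (0 : ℝ) 1)
    (X : Fin K → ℕ → Ω → ℝ) (hX : ThresholdingBandit.IsRewardTable P ν X)
    (α : ℝ) (hα : 0 < α) (hα8 : α ≤ 8)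
    (T : ℕ) (hT : max (40 / α + 1) 40 * (K : ℝ) ≤ (T : ℝ))
    (I : ℕ → Ω → Fin K) (hI : ThresholdingBandit.IsLSARun α θ X T I) :
    (∃! Λ : ℝ, ThresholdingBandit.IsLevel α (ThresholdingBandit.gap θ ν) T Λ) ∧
    ∀ Λ : ℝ, ThresholdingBandit.IsLevel α (ThresholdingBandit.gap θ ν) T Λ →
      ThresholdingBandit.aggregateRegret P θ ν (ThresholdingBandit.lsaOutput θ X I T) ≤
        ThresholdingBandit.lsaConst α *
          ∑ i, Real.exp (-(ThresholdingBandit.allocation α (ThresholdingBandit.gap θ ν i) Λ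
            * ThresholdingBandit.gap θ ν i ^ 2) / 10) := by
  open ThresholdingBandit in
  refine ⟨existsUnique_isLevel hK hα gap_nonneg (gap_le_one hν hθ) hT, fun Λ hΛ => ?_⟩
  rw [Finset.mul_sum]
  refine aggregateRegret_le (fun i => ?_) fun i => meas_incorrect_le hν hθ hX hα hT hI hΛ i
  have hG := one_le_lsaGeomConst hα
  have hC := one_le_lsaExpConst hα
  rw [lsaConst_eq]
  positivity
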